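/- **Conventions.** A *tableau* is a semistandard Young tableau with integer entries (rows weakly increasing from left to right, columns strictly increasing from top to bottom); $\emptyset$ is the empty tableau. The product $T\cdot U$ is the usual product of tableaux: the letters of the word of $U$ (rows read left to right, from the bottom row to the top row) are successively row inserted in $T$. A factorization of $W$ is an equation expressing $W$ as a product of tableaux. *Rank conditions* are non-negative integers $r_{ij}$ $(0\le i\le j\le n)$, $n\ge 1$, with $r_{ij}\le\min(r_{i,j-1},r_{i+1,j})$ for $i<j$ and $r_{ij}-r_{i,j-1}-r_{i+1,j}+r_{i+1,j-1}\ge 0$ for $j-i\ge 2$. For $i<j$ let $R_{ij}$ be the rectangle with $r_{i+1,j}-r_{ij}$ rows and $r_{i,j-1}-r_{ij}$ columns (either number may be $0$, and is remembered even if the rectangle is empty). A *tableau diagram* for $r$ consists of a tableau $T_{ij}$ of shape $R_{ij}$ for all $0\le i<j\le n$, such that the entries of $T_{ij}$ are strictly larger than the entries of every $T_{kl}$ with $i\le k<l\le j$ and $(k,l)\ne(i,j)$. It has $n$ rows, the $d$-th row being $T_{0,d},T_{1,d+1},\dots,T_{n-d,n}$. Its bottom $n-1$ rows form the tableau diagram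 $\{T_{i,j+1}\}_{0\le i<j\le n-1}$ for the rank conditions $(r_{i,j+1})_{0\le i\le j\le n-1}$. *Factor sequences* for a tableau diagram with $n$ rows are sequences of $n$ tableaux defined by induction. If $n=1$, the only factor sequence is $(T_{01})$. If $n\ge2$, the factor sequences are the sequences $$(T_{01}\cdot P_1,\; Q_1\cdot T_{12}\cdot P_2,\;\dots,\; Q_{n-2}\cdot T_{n-2,n-1}\cdot P_{n-1},\; Q_{n-1}\cdot T_{n-1,n}),$$ where $(U_1,\dots,U_{n-1})$ is a factor sequence for the bottom $n-1$ rows and $U_i=P_i\cdot Q_i$ are arbitrary factorizations. (By convention the empty sequence is the only factor sequence for the diagram with no rows.) Let $W$ be a tableau whose shape contains the rectangle $(b)^a$ with $a$ rows and $b$ columns. Let $T$ be the part of $W$ in this rectangle, $P_0$ the rest of the top $a$ rows of $W$, $Q_0$ the part of the first $b$ columns of $W$ below row $a$, and $Z$ the part of $W$ in the rows after row $a$ and the columns after column $b$. A *simple factorization* of $W$ with respect to $(b)^a$ is a factorization $W=Q\cdot T\cdot P$ such that $Q=Q_0\cdot\tilde Q$ and $P=\tilde P\cdot P_0$ for some factorization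 $Z=\tilde Q\cdot\tilde P$. **Theorem.** Let $n\ge 1$, let $\{T_{ij}\}$ be a tableau diagram with $n$ rows, and let $(W_1,\dots,W_n)$ be a sequence of tableaux such that each $W_i$ contains $T_{i-1,i}$ in its upper-left corner. For each $i$ let $W_i=Q_{i-1}\cdot T_{i-1,i}\cdot P_i$ be any simple factorization of $W_i$ with respect to the rectangle $R_{i-1,i}$. Then $(W_1,\dots,W_n)$ is a factor sequence for $\{T_{ij}\}$ if and only if $Q_0$ and $P_n$ are empty tableaux and $(P_1\cdot Q_1,\dots,P_{n-1}\cdot Q_{n-1})$ is a factor sequence for the bottom $n-1$ rows of $\{T_{ij}\}$. -/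

import Mathlib

/-! ### Semistandard tableaux with integer entries -/

/-- `ColLT r s`: the row `s` can stand below the row `r`, i.e. `s` is at most as long as `r`
and each entry of `s` is strictly larger than the entry of `r` in the same column. -/
def ColLT : List ℤ → List ℤ → Prop
  | _, [] => True
  | [], _ :: _ => False
  | x :: r, y :: s => x < y ∧ ColLT r s

/-- A list of rows (top row first) is a semistandard tableau: its rows are non-empty and weakly
increasing, their lengths weakly decrease, and the columns are strictly increasing. -/
structure IsTableau (rows : List (List ℤ)) : Prop where
  ne_nil : ∀ r ∈ rows, r ≠ []
  row_weak : ∀ r ∈ rows, r.Pairwise (· ≤ ·)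
  col_strict : rows.Pairwise ColLT

/-- Semistandard Young tableaux with entries in `ℤ`, given by their rows from top to bottom. -/
@[ext]
structure Tableau where
  rows : List (List ℤ)
  isTableau : IsTableau rows

/-- Row bumping in one row: if some entry is strictly larger than `x`, then `x` replaces the
leftmost such entry, which is returned; otherwise `x` is put at the end of the row. -/
def rowInsert (x : ℤ) : List ℤ → List ℤ × Option ℤ
  | [] => ([x], none)
  | y :: r => if x < y then (x :: r, some y) else (y :: (rowInsert x r).1, (rowInsert x r).2)

/-- Row insertion of `x` in a tableau: insert `x` in the first row, insert the entry
bumped out of it (if any) in the second row, and so on. -/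
def insertRows (x : ℤ) : List (List ℤ) → List (List ℤ)
  | [] => [[x]]
  | r :: rs => (rowInsert x r).1 ::
      match (rowInsert x r).2 with
      | none => rs
      | some y => insertRows y rs

theorem ColLT.trans : ∀ {r s t : List ℤ}, ColLT r s → ColLT s t → ColLT r t
  | _, _, [], _, _ => by simp [ColLT]
  | _, [], _ :: _, _, h => by simp [ColLT] at h
  | [], _ :: _, _ :: _, h, _ => by simp [ColLT] at h
  | _ :: _, _ :: _, _ :: _, h, h' => ⟨h.1.trans h'.1, ColLT.trans h.2 h'.2⟩

theorem ColLT.take (b : ℕ) : ∀ {r s : List ℤ}, ColLT r s → ColLT (r.take b) (s.take b) := by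
  induction b with
  | zero => intro r s _; simp [ColLT]
  | succ b ih =>
    intro r s h
    cases s with
    | nil => simp [ColLT]
    | cons y s =>
      cases r with
      | nil => simp [ColLT] at h
      | cons x r => exact ⟨h.1, ih h.2⟩

theorem ColLT.drop (b : ℕ) : ∀ {r s : List ℤ}, ColLT r s → ColLT (r.drop b) (s.drop b) := by
  induction b with
  | zero => intro r s h; simpa using h
  | succ b ih =>
    intro r s h
    cases s with
    | nil => simp [ColLT]
    | cons y s =>
      cases r with
      | nil => simp [ColLT] at h
      | cons x r => exact ih h.2

theorem rowInsert_ne_nil (x : ℤ) (r : List ℤ) : (rowInsert x r).1 ≠ [] := by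
  cases r with
  | nil => simp [rowInsert]
  | cons y r => simp only [rowInsert]; split <;> simp

theorem mem_rowInsert {x z : ℤ} : ∀ {r : List ℤ}, z ∈ (rowInsert x r).1 → z = x ∨ z ∈ r
  | [], h => by simpa [rowInsert] using h
  | y :: r, h => by
    simp only [rowInsert] at h
    split at h
    · simp only [List.mem_cons] at h ⊢; tauto
    · simp only [List.mem_cons] at h ⊢
      rcases h with h | h
      · tauto
      · have := mem_rowInsert h; tauto

theorem rowInsert_sorted (x : ℤ) :
    ∀ {r : List ℤ}, r.Pairwise (· ≤ ·) → (rowInsert x r).1.Pairwise (· ≤ ·)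
  | [], _ => by simp [rowInsert]
  | y :: r, h => by
    rw [List.pairwise_cons] at h
    simp only [rowInsert]
    split
    · rename_i hxy
      rw [List.pairwise_cons]
      exact ⟨fun z hz => hxy.le.trans (h.1 z hz), h.2⟩
    · rename_i hxy
      rw [List.pairwise_cons]
      refine ⟨fun z hz => ?_, rowInsert_sorted x h.2⟩
      rcases mem_rowInsert hz with rfl | hz
      · exact not_lt.mp hxy
      · exact h.1 z hz

theorem ColLT.rowInsert_left (x : ℤ) : ∀ {r s : List ℤ}, ColLT r s → ColLT (rowInsert x r).1 s
  | _, [], _ => by simp [ColLT]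
  | [], _ :: _, h => by simp [ColLT] at h
  | y :: r, z :: s, h => by
    simp only [rowInsert]
    split
    · rename_i hxy; exact ⟨hxy.trans h.1, h.2⟩
    · exact ⟨h.1, h.2.rowInsert_left x⟩

theorem lt_of_rowInsert {x y : ℤ} : ∀ {r : List ℤ}, (rowInsert x r).2 = some y → x < y
  | [], h => by simp [rowInsert] at h
  | z :: r, h => by
    simp only [rowInsert] at h
    split at h
    · rename_i hxz; simp only [Option.some.injEq] at h; omega
    · exact lt_of_rowInsert h

theorem ColLT.rowInsert_both {x y : ℤ} : ∀ {r s : List ℤ}, ColLT r s →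
    (rowInsert x r).2 = some y → ColLT (rowInsert x r).1 (rowInsert y s).1
  | [], _, _, h => by simp [rowInsert] at h
  | z :: r, [], _, h => by
    have hxy := lt_of_rowInsert h
    simp only [rowInsert] at h ⊢
    split
    · simp [ColLT, hxy]
    · rename_i hxz; simp only [ColLT, and_true]; omega
  | z :: r, w :: s, hc, h => by
    have hxy := lt_of_rowInsert h
    obtain ⟨hzw, hc⟩ := hc
    simp only [rowInsert] at h
    split at h
    · rename_i hxz
      simp only [Option.some.injEq] at h
      subst h
      simp only [rowInsert, hxz, hzw, if_true]
      exact ⟨hxy, hc⟩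
    · rename_i hxz
      simp only [rowInsert, hxz, if_false]
      split
      · exact ⟨by omega, hc.rowInsert_left x⟩
      · exact ⟨hzw, hc.rowInsert_both h⟩

theorem isTableau_cons {r : List ℤ} {rs : List (List ℤ)} :
    IsTableau (r :: rs) ↔
      r ≠ [] ∧ r.Pairwise (· ≤ ·) ∧ (∀ s ∈ rs, ColLT r s) ∧ IsTableau rs := by
  constructor
  · rintro ⟨h1, h2, h3⟩
    simp only [List.forall_mem_cons, List.pairwise_cons] at h1 h2 h3
    exact ⟨h1.1, h2.1, h3.1, h1.2, h2.2, h3.2⟩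
  · rintro ⟨h1, h2, h3, h4, h5, h6⟩
    exact ⟨List.forall_mem_cons.2 ⟨h1, h4⟩, List.forall_mem_cons.2 ⟨h2, h5⟩,
      List.pairwise_cons.2 ⟨h3, h6⟩⟩

theorem isTableau_nil : IsTableau [] := ⟨by simp, by simp, by simp⟩

theorem IsTableau.insertRows (x : ℤ) {rows : List (List ℤ)} (h : IsTableau rows) :
    IsTableau (insertRows x rows) := by
  induction rows generalizing x with
  | nil => exact isTableau_cons.2 ⟨by simp, by simp, by simp, isTableau_nil⟩
  | cons r rs ih =>
    obtain ⟨_, h2, h3, h4⟩ := isTableau_cons.1 h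
    simp only [_root_.insertRows]
    split
    · exact isTableau_cons.2 ⟨rowInsert_ne_nil x r, rowInsert_sorted x h2,
        fun s hs => (h3 s hs).rowInsert_left x, h4⟩
    · rename_i y hy
      refine isTableau_cons.2 ⟨rowInsert_ne_nil x r, rowInsert_sorted x h2, ?_, ih y h4⟩
      have ht := ih y h4
      cases rs with
      | nil =>
        have := ColLT.rowInsert_both (s := []) (by simp [ColLT]) hy
        simpa [_root_.insertRows, rowInsert] using this
      | cons s rs =>
        have key := (h3 s (by simp)).rowInsert_both hy
        simp only [_root_.insertRows] at ht ⊢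
        intro t hmem
        rcases List.mem_cons.1 hmem with rfl | hmem
        · exact key
        · exact key.trans ((isTableau_cons.1 ht).2.2.1 t hmem)

theorem IsTableau.foldl_insertRows (w : List ℤ) {rows : List (List ℤ)} (h : IsTableau rows) :
    IsTableau (w.foldl (fun t x => _root_.insertRows x t) rows) := by
  induction w generalizing rows with
  | nil => exact h
  | cons x w ih => exact ih (h.insertRows x)

theorem IsTableau.of_sublist {rows rows' : List (List ℤ)} (h : IsTableau rows)
    (hs : rows'.Sublist rows) : IsTableau rows' :=
  ⟨fun r hr => h.ne_nil r (hs.subset hr), fun r hr => h.row_weak r (hs.subset hr),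
    h.col_strict.sublist hs⟩

theorem IsTableau.map_filter {rows : List (List ℤ)} (h : IsTableau rows) (f : List ℤ → List ℤ)
    (hf : ∀ r, (f r).Sublist r) (hc : ∀ r s, ColLT r s → ColLT (f r) (f s)) :
    IsTableau ((rows.map f).filter (· ≠ [])) := by
  refine ⟨fun r hr => by simpa using (List.mem_filter.1 hr).2, fun r hr => ?_, ?_⟩
  · obtain ⟨s, hs, rfl⟩ := List.mem_map.1 (List.mem_filter.1 hr).1
    exact (h.row_weak s hs).sublist (hf s)
  · exact (List.Pairwise.map f hc h.col_strict).sublist List.filter_sublist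

namespace Tableau

instance : EmptyCollection Tableau := ⟨⟨[], isTableau_nil⟩⟩

/-- The entry in row `i` and column `j` (counted from `0`), `none` if there is no such box. -/
def entry (T : Tableau) (i j : ℕ) : Option ℤ := T.rows[i]?.bind fun r => r[j]?

/-- The (row) word of a tableau: its rows read from left to right, from the bottom row to the
top row. -/
def word (T : Tableau) : List ℤ := T.rows.reverse.flatten

/-- The product `T · U` of tableaux: the letters of the word of `U` are successively
row inserted in `T`. -/
instance : Mul Tableau :=
  ⟨fun T U => ⟨U.word.foldl (fun t x => insertRows x t) T.rows, T.isTableau.foldl_insertRows _⟩⟩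

/-- The top `a` rows. -/
def top (a : ℕ) (T : Tableau) : Tableau :=
  ⟨T.rows.take a, T.isTableau.of_sublist (List.take_sublist a _)⟩

/-- The part below the top `a` rows. -/
def below (a : ℕ) (T : Tableau) : Tableau :=
  ⟨T.rows.drop a, T.isTableau.of_sublist (List.drop_sublist a _)⟩

/-- The first `b` columns. -/
def left (b : ℕ) (T : Tableau) : Tableau :=
  ⟨(T.rows.map (List.take b)).filter (· ≠ []),
    T.isTableau.map_filter _ (List.take_sublist b) fun _ _ h => h.take b⟩

/-- The part to the right of the first `b` columns. -/
def right (b : ℕ) (T : Tableau) : Tableau :=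
  ⟨(T.rows.map (List.drop b)).filter (· ≠ []),
    T.isTableau.map_filter _ (List.drop_sublist b) fun _ _ h => h.drop b⟩

/-- The shape of `T` is the rectangle `(b)^a` with `a` rows and `b` columns
(so `T` is empty if `a = 0` or `b = 0`). -/
def IsRect (a b : ℕ) (T : Tableau) : Prop :=
  ∀ i j, (T.entry i j).isSome ↔ i < a ∧ j < b

/-- `W` contains the tableau `T` in its upper-left corner. -/
def ContainsUpperLeft (W T : Tableau) : Prop :=
  ∀ i j x, T.entry i j = some x → W.entry i j = some x

/-- `W = Q · T · P` is a simple factorization of `W` with respect to the rectangle `(b)^a`.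
Here `T` is the part of `W` in this rectangle, `Q₀ = (W.below a).left b` is the part of `W`
below `T`, `P₀ = (W.top a).right b` is the part to the right of `T`, and
`Z = (W.below a).right b` is the remaining part. -/
def IsSimpleFactorization (a b : ℕ) (W Q T P : Tableau) : Prop :=
  T = (W.top a).left b ∧ W = Q * T * P ∧
    ∃ Q' P' : Tableau, (W.below a).right b = Q' * P' ∧
      Q = (W.below a).left b * Q' ∧ P = P' * (W.top a).right b

end Tableau

/-! ### Rank conditions and tableau diagrams -/

/-- Rank conditions `r i j`, `0 ≤ i ≤ j ≤ n`, that can occur; the values of `r` at other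
indices are irrelevant. -/
structure RankConditions (n : ℕ) where
  r : ℕ → ℕ → ℕ
  le_left : ∀ i j, i < j → j ≤ n → r i j ≤ r i (j - 1)
  le_right : ∀ i j, i < j → j ≤ n → r i j ≤ r (i + 1) j
  occur : ∀ i j, i + 2 ≤ j → j ≤ n → r i (j - 1) + r (i + 1) j ≤ r i j + r (i + 1) (j - 1)

namespace RankConditions

/-- The number of rows of the rectangle `R i j`, for `i < j`. -/
def numRows {n : ℕ} (r : RankConditions n) (i j : ℕ) : ℕ := r.r (i + 1) j - r.r i j

/-- The number of columns of the rectangle `R i j`, for `i < j`. -/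
def numCols {n : ℕ} (r : RankConditions n) (i j : ℕ) : ℕ := r.r i (j - 1) - r.r i j

/-- The rank conditions obtained by removing the top row of the rank diagram. -/
def bottom {n : ℕ} (r : RankConditions (n + 1)) : RankConditions n where
  r i j := r.r i (j + 1)
  le_left i j h h' := by
    have := r.le_left i (j + 1) (by omega) (by omega)
    rwa [show j + 1 - 1 = j - 1 + 1 by omega] at this
  le_right i j h h' := r.le_right i (j + 1) (by omega) (by omega)
  occur i j h h' := by
    have := r.occur i (j + 1) (by omega) (by omega)
    rwa [show j + 1 - 1 = j - 1 + 1 by omega] at this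

end RankConditions

/-- A tableau diagram for the rank conditions `r`: a tableau `T i j` of shape `R i j` for all
`0 ≤ i < j ≤ n`, whose entries are strictly larger than the entries of each `T k l` with
`i ≤ k < l ≤ j` and `(k, l) ≠ (i, j)`. The values of `T` at other indices are irrelevant. -/
structure TableauDiagram {n : ℕ} (r : RankConditions n) where
  T : ℕ → ℕ → Tableau
  isRect : ∀ i j, i < j → j ≤ n → (T i j).IsRect (r.numRows i j) (r.numCols i j)
  lt : ∀ i j k l, i ≤ k → k < l → l ≤ j → j ≤ n → (k, l) ≠ (i, j) →
    ∀ x ∈ (T k l).word, ∀ y ∈ (T i j).word, x < y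

/-- The tableau diagram formed by all rows but the top one. -/
def TableauDiagram.bottom {n : ℕ} {r : RankConditions (n + 1)} (D : TableauDiagram r) :
    TableauDiagram r.bottom where
  T i j := D.T i (j + 1)
  isRect i j h h' := by
    have := D.isRect i (j + 1) (by omega) (by omega)
    simp only [RankConditions.numRows, RankConditions.numCols, RankConditions.bottom] at this ⊢
    rwa [show j + 1 - 1 = j - 1 + 1 by omega] at this
  lt i j k l h1 h2 h3 h4 h5 := D.lt i (j + 1) k (l + 1) h1 (by omega) (by omega) (by omega)
    (by simpa using h5)

/-- Factor sequences for a tableau diagram with `n` rows. The sequence `(W_1, …, W_n)` is indexed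
by `Fin n`, i.e. `W i` stands for `W_{i+1}`. The case of no rows is the convention
that the empty sequence is a factor sequence for the empty diagram. In the last case, `P i` and
`Q i` stand for `P_{i+1}` and `Q_{i+1}`. -/
def IsFactorSequence : {n : ℕ} → {r : RankConditions n} → TableauDiagram r →
    (Fin n → Tableau) → Prop
  | 0, _, _, _ => True
  | 1, _, D, W => W 0 = D.T 0 1
  | n + 2, _, D, W =>
    ∃ U P Q : Fin (n + 1) → Tableau,
      IsFactorSequence D.bottom U ∧
      (∀ i, U i = P i * Q i) ∧
      W 0 = D.T 0 1 * P 0 ∧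
      (∀ i : Fin n, W i.succ.castSucc =
        Q i.castSucc * D.T (i + 1) (i + 2) * P i.succ) ∧
      W (Fin.last (n + 1)) = Q (Fin.last n) * D.T (n + 1) (n + 2)

/-!
Row insertion respects the Knuth relations, so tableaux form a semigroup in which `T` may be
replaced by any word that inserts to it. Row insertion never moves entries upwards: the top rows
of `P · B` depend only on the top rows of `P`, and the rows of `P` below them act as a left
factor. Column insertion gives the transposed statement for the left columns of `A · Q`. Hence if
a right factor `E` is split off the part of `Q` right of some column, then it is split off `A · Q`
in the same way, and similarly for a left factor `C` of the part of `P` below some row.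

In a product `Q · T · P` whose rectangle `T` has smaller entries than `Q` and `P`, the part of `Q`
right of `T` slides through `T` to the right, and the part of `P` below `T` slides through `T` to
the left. Such a slide at the index `i` moves a factor between the neighbouring products `P_{i-1}
· Q_{i-1}` and `P_i · Q_i`. Since `R_{i-1,i+1}` has at most as many rows as `R_{i-1,i}` and at
most as many columns as `R_{i,i+1}`, this factor also lies outside the rectangle of the bottom
rows at which it is split off, and by induction on the number of rows the bottom sequence remains
a factor sequence. Three slides turn an arbitrary factorization of a single `W_i` into any given
simple one.
-/

/-! ### Row insertion of words -/

/-- Successive row insertion of the letters of a word in a list of rows: the operation defining the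
product of tableaux, for rows that need not form a tableau. -/
def insertWord (T : List (List ℤ)) (w : List ℤ) : List (List ℤ) :=
  w.foldl (fun t x => insertRows x t) T

/-- Successive insertion of the letters of a word in a single row: the resulting row, and the word
formed by the entries that are bumped out, in the order in which they leave the row. -/
def rowInsertWord : List ℤ → List ℤ → List ℤ × List ℤ
  | r, [] => (r, [])
  | r, x :: w => ((rowInsertWord (rowInsert x r).1 w).1,
      (rowInsert x r).2.toList ++ (rowInsertWord (rowInsert x r).1 w).2)

@[simp] theorem insertWord_nil (T : List (List ℤ)) : insertWord T [] = T := rfl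

@[simp] theorem insertWord_cons (T : List (List ℤ)) (x : ℤ) (w : List ℤ) :
    insertWord T (x :: w) = insertWord (insertRows x T) w := rfl

theorem insertWord_append (T : List (List ℤ)) (u w : List ℤ) :
    insertWord T (u ++ w) = insertWord (insertWord T u) w := List.foldl_append ..

theorem IsTableau.insertWord {T : List (List ℤ)} (h : IsTableau T) (w : List ℤ) :
    IsTableau (insertWord T w) := h.foldl_insertRows w

theorem insertWord_rows_cons (r : List ℤ) (rs : List (List ℤ)) (w : List ℤ) :
    insertWord (r :: rs) w = (rowInsertWord r w).1 :: insertWord rs (rowInsertWord r w).2 := by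
  induction w generalizing r rs with
  | nil => rfl
  | cons x w ih =>
    simp only [insertWord_cons, insertRows, rowInsertWord]
    rcases (rowInsert x r).2 with _ | y <;> simp [ih]

theorem insertWord_nil_rows {w : List ℤ} (hw : w ≠ []) :
    insertWord [] w = (rowInsertWord [] w).1 :: insertWord [] (rowInsertWord [] w).2 := by
  obtain ⟨x, w, rfl⟩ := List.exists_cons_of_ne_nil hw
  exact insertWord_rows_cons [x] [] w

theorem rowInsert_cons_of_lt {x h : ℤ} (hx : x < h) (r : List ℤ) :
    rowInsert x (h :: r) = (x :: r, some h) := by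
  simp [rowInsert, hx]

theorem rowInsert_cons_of_le {x h : ℤ} (hx : h ≤ x) (r : List ℤ) :
    rowInsert x (h :: r) = (h :: (rowInsert x r).1, (rowInsert x r).2) := by
  simp [rowInsert, hx.not_gt]

theorem rowInsertWord_cons_of_le {h : ℤ} {w : List ℤ} (hw : ∀ x ∈ w, h ≤ x) (r : List ℤ) :
    rowInsertWord (h :: r) w = (h :: (rowInsertWord r w).1, (rowInsertWord r w).2) := by
  induction w generalizing r with
  | nil => rfl
  | cons x w ih =>
    rw [List.forall_mem_cons] at hw
    simp only [rowInsertWord, rowInsert_cons_of_le hw.1, ih hw.2]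

theorem rowInsertWord_append_of_le {l w : List ℤ} (hw : ∀ h ∈ l, ∀ x ∈ w, h ≤ x) (r : List ℤ) :
    rowInsertWord (l ++ r) w = (l ++ (rowInsertWord r w).1, (rowInsertWord r w).2) := by
  induction l with
  | nil => rfl
  | cons h l ih =>
    rw [List.forall_mem_cons] at hw
    rw [List.cons_append, rowInsertWord_cons_of_le hw.1, ih hw.2]
    rfl

theorem self_mem_rowInsert (x : ℤ) (r : List ℤ) : x ∈ (rowInsert x r).1 := by
  induction r with
  | nil => simp [rowInsert]
  | cons y r ih => simp only [rowInsert]; split <;> simp [ih]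

theorem mem_of_rowInsert_eq_some {x y : ℤ} {r : List ℤ} (h : (rowInsert x r).2 = some y) :
    y ∈ r := by
  induction r with
  | nil => simp [rowInsert] at h
  | cons z r ih =>
    rcases lt_or_ge x z with hxz | hzx
    · simp_all [rowInsert_cons_of_lt hxz]
    · exact List.mem_cons_of_mem _ (ih (by simpa [rowInsert_cons_of_le hzx] using h))

theorem rowInsert_eq_some_of_lt {x z : ℤ} {r : List ℤ} (hr : r.Pairwise (· ≤ ·)) (hz : z ∈ r)
    (hxz : x < z) : ∃ y, (rowInsert x r).2 = some y ∧ y ≤ z := by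
  induction r with
  | nil => simp at hz
  | cons h r ih =>
    rw [List.pairwise_cons] at hr
    rcases lt_or_ge x h with hxh | hhx
    · refine ⟨h, by rw [rowInsert_cons_of_lt hxh], ?_⟩
      rcases List.mem_cons.1 hz with rfl | hz
      exacts [le_rfl, hr.1 z hz]
    · rcases List.mem_cons.1 hz with rfl | hz
      · exact absurd hxz hhx.not_gt
      · simpa only [rowInsert_cons_of_le hhx] using ih hr.2 hz

theorem rowInsert_eq_append {x : ℤ} {r : List ℤ} (h : (rowInsert x r).2 = none) :
    (rowInsert x r).1 = r ++ [x] := by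
  induction r with
  | nil => rfl
  | cons k r ih =>
    rcases lt_or_ge x k with hxk | hkx
    · simp [rowInsert_cons_of_lt hxk] at h
    · rw [rowInsert_cons_of_le hkx] at h ⊢
      rw [ih h, List.cons_append]

theorem rowInsert_perm (x : ℤ) (r : List ℤ) :
    ((rowInsert x r).2.toList ++ (rowInsert x r).1).Perm (x :: r) := by
  induction r with
  | nil => simp [rowInsert]
  | cons k r ih =>
    rcases lt_or_ge x k with hxk | hkx
    · simpa [rowInsert_cons_of_lt hxk] using List.Perm.swap x k r
    · rw [rowInsert_cons_of_le hkx]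
      exact List.perm_middle.trans ((ih.cons k).trans (List.Perm.swap x k r))

/-! ### The plactic relations -/

/-- The elementary Knuth relations between words of three letters, together with equality. Equality
is included because two Knuth related words may bump the same word out of a row. -/
inductive Knuth : List ℤ → List ℤ → Prop
  | refl (w : List ℤ) : Knuth w w
  | yzx {x y z : ℤ} : x < y → y ≤ z → Knuth [y, z, x] [y, x, z]
  | xzy {x y z : ℤ} : x ≤ y → y < z → Knuth [x, z, y] [z, x, y]

theorem Knuth.rowInsertWord_nil {w w' : List ℤ} (hk : Knuth w w') :
    rowInsertWord [] w = rowInsertWord [] w' := by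
  cases hk with
  | refl => rfl
  | yzx h1 h2 => simp [rowInsertWord, rowInsert, h1, h2.not_gt, (h1.trans_le h2).not_gt]
  | xzy h1 h2 =>
    simp [rowInsertWord, rowInsert, h2, h1.not_gt, h1.trans_lt h2, (h1.trans_lt h2).not_gt]

theorem rowInsertWord_yzx_of_lt {x y z h : ℤ} {r : List ℤ} (hr : (h :: r).Pairwise (· ≤ ·))
    (hxy : x < y) (hyz : y ≤ z) (hxh : x < h) :
    (rowInsertWord (h :: r) [y, z, x]).1 = (rowInsertWord (h :: r) [y, x, z]).1 ∧
      Knuth (rowInsertWord (h :: r) [y, z, x]).2 (rowInsertWord (h :: r) [y, x, z]).2 := by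
  rw [List.pairwise_cons] at hr
  have hxz : x ≤ z := hxy.le.trans hyz
  rcases lt_or_ge y h with hyh | hhy
  · simp only [rowInsertWord, rowInsert_cons_of_lt hyh, rowInsert_cons_of_lt hxy,
      rowInsert_cons_of_le hyz, rowInsert_cons_of_le hxz, true_and]
    rcases hz : (rowInsert z r).2 with _ | z'
    · exact .refl _
    · exact .yzx hyh (hr.1 _ (mem_of_rowInsert_eq_some hz))
  · simp only [rowInsertWord, rowInsert_cons_of_le hhy, rowInsert_cons_of_le (hhy.trans hyz),
      rowInsert_cons_of_lt hxh, rowInsert_cons_of_le hxz, true_and]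
    rcases hz : (rowInsert z (rowInsert y r).1).2 with _ | z'
    · exact .refl _
    · obtain ⟨y', hy, hyz'⟩ : ∃ y', (rowInsert y r).2 = some y' ∧ y' ≤ z' := by
        have hzz := lt_of_rowInsert hz
        rcases mem_rowInsert (mem_of_rowInsert_eq_some hz) with rfl | hz'
        · exact absurd hzz hyz.not_gt
        · exact rowInsert_eq_some_of_lt hr.2 hz' (hyz.trans_lt hzz)
      rw [hy]
      exact .yzx (hhy.trans_lt (lt_of_rowInsert hy)) hyz'

theorem rowInsertWord_xzy_of_lt {x y z h : ℤ} {r : List ℤ} (hr : (h :: r).Pairwise (· ≤ ·))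
    (hxy : x ≤ y) (hyz : y < z) (hxh : x < h) :
    (rowInsertWord (h :: r) [x, z, y]).1 = (rowInsertWord (h :: r) [z, x, y]).1 ∧
      Knuth (rowInsertWord (h :: r) [x, z, y]).2 (rowInsertWord (h :: r) [z, x, y]).2 := by
  rw [List.pairwise_cons] at hr
  have hxz : x < z := hxy.trans_lt hyz
  rcases lt_or_ge z h with hzh | hhz
  · cases r with
    | nil =>
      simp [rowInsertWord, rowInsert, hxh, hzh, hyz, hxz, hxy.not_gt, hxz.not_gt, Knuth.refl]
    | cons k r =>
      have hhk : h ≤ k := hr.1 k (by simp)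
      have hzk : z < k := hzh.trans_le hhk
      simp only [rowInsertWord, rowInsert_cons_of_lt hxh, rowInsert_cons_of_lt hzh,
        rowInsert_cons_of_lt hxz, rowInsert_cons_of_le hxz.le, rowInsert_cons_of_le hxy,
        rowInsert_cons_of_lt hzk, rowInsert_cons_of_lt hyz, rowInsert_cons_of_lt (hyz.trans hzk),
        true_and]
      exact .yzx hzh hhk
  · simp only [rowInsertWord, rowInsert_cons_of_lt hxh, rowInsert_cons_of_le hhz,
      rowInsert_cons_of_le hxz.le, rowInsert_cons_of_le hxy, true_and]
    obtain ⟨y', hy, hyz'⟩ := rowInsert_eq_some_of_lt (rowInsert_sorted z hr.2)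
      (self_mem_rowInsert z r) hyz
    rcases hz : (rowInsert z r).2 with _ | z'
    · exact .refl _
    · rw [hy]
      refine .xzy ?_ (hyz'.trans_lt (lt_of_rowInsert hz))
      rcases mem_rowInsert (mem_of_rowInsert_eq_some hy) with rfl | hy'
      exacts [hhz, hr.1 _ hy']

theorem rowInsertWord_of_knuth {w w' : List ℤ} (hk : Knuth w w') {r : List ℤ}
    (hr : r.Pairwise (· ≤ ·)) :
    (rowInsertWord r w).1 = (rowInsertWord r w').1 ∧
      Knuth (rowInsertWord r w).2 (rowInsertWord r w').2 := by
  induction r with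
  | nil => rw [hk.rowInsertWord_nil]; exact ⟨rfl, .refl _⟩
  | cons h r ih =>
    have ih := ih (List.pairwise_cons.1 hr).2
    have of_le (hw : ∀ t ∈ w, h ≤ t) (hw' : ∀ t ∈ w', h ≤ t) :
        (rowInsertWord (h :: r) w).1 = (rowInsertWord (h :: r) w').1 ∧
          Knuth (rowInsertWord (h :: r) w).2 (rowInsertWord (h :: r) w').2 := by
      rw [rowInsertWord_cons_of_le hw, rowInsertWord_cons_of_le hw']
      exact ⟨congrArg (h :: ·) ih.1, ih.2⟩
    cases hk with
    | refl => exact ⟨rfl, .refl _⟩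
    | @yzx x y z hxy hyz =>
      rcases lt_or_ge x h with hxh | hhx
      · exact rowInsertWord_yzx_of_lt hr hxy hyz hxh
      · exact of_le (by simp; omega) (by simp; omega)
    | @xzy x y z hxy hyz =>
      rcases lt_or_ge x h with hxh | hhx
      · exact rowInsertWord_xzy_of_lt hr hxy hyz hxh
      · exact of_le (by simp; omega) (by simp; omega)

/-- Two words are plactically equivalent if inserting either of them in any tableau has the same
result. -/
def PlacticEquiv (w w' : List ℤ) : Prop :=
  ∀ T, IsTableau T → insertWord T w = insertWord T w'

theorem Knuth.placticEquiv {w w' : List ℤ} (hk : Knuth w w') : PlacticEquiv w w' := by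
  intro T hT
  induction T generalizing w w' with
  | nil =>
    cases hk with
    | refl => rfl
    | @yzx x y z hxy hyz =>
      rw [insertWord_nil_rows (List.cons_ne_nil y _), insertWord_nil_rows (List.cons_ne_nil y _),
        (Knuth.yzx hxy hyz).rowInsertWord_nil]
    | @xzy x y z hxy hyz =>
      rw [insertWord_nil_rows (List.cons_ne_nil x _), insertWord_nil_rows (List.cons_ne_nil z _),
        (Knuth.xzy hxy hyz).rowInsertWord_nil]
  | cons r rs ih =>
    obtain ⟨_, hr, _, hrs⟩ := isTableau_cons.1 hT
    obtain ⟨hrow, hbumped⟩ := rowInsertWord_of_knuth hk hr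
    rw [insertWord_rows_cons, insertWord_rows_cons, hrow, ih hbumped hrs]

namespace PlacticEquiv

variable {u v w u' v' : List ℤ}

theorem refl (w : List ℤ) : PlacticEquiv w w := fun _ _ => rfl

theorem symm (h : PlacticEquiv u v) : PlacticEquiv v u := fun T hT => (h T hT).symm

theorem trans (h : PlacticEquiv u v) (h' : PlacticEquiv v w) : PlacticEquiv u w :=
  fun T hT => (h T hT).trans (h' T hT)

theorem append (h : PlacticEquiv u u') (h' : PlacticEquiv v v') :
    PlacticEquiv (u ++ v) (u' ++ v') := fun T hT => by
  rw [insertWord_append, insertWord_append, h T hT, h' _ (hT.insertWord u')]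

theorem append_left (u : List ℤ) (h : PlacticEquiv v v') : PlacticEquiv (u ++ v) (u ++ v') :=
  (refl u).append h

theorem append_right (h : PlacticEquiv u u') (v : List ℤ) : PlacticEquiv (u ++ v) (u' ++ v) :=
  h.append (refl v)

theorem cons (x : ℤ) (h : PlacticEquiv v v') : PlacticEquiv (x :: v) (x :: v') := append_left [x] h

end PlacticEquiv

theorem placticEquiv_cons_append_singleton {x h : ℤ} {r : List ℤ} (hx : x < h)
    (hr : (h :: r).Pairwise (· ≤ ·)) : PlacticEquiv (h :: (r ++ [x])) (h :: x :: r) := by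
  induction r generalizing h with
  | nil => exact .refl _
  | cons k r ih =>
    rw [List.pairwise_cons] at hr
    have hhk : h ≤ k := hr.1 k (by simp)
    exact ((ih (hx.trans_le hhk) hr.2).cons h).trans
      ((Knuth.yzx hx hhk).placticEquiv.append_right r)

theorem exists_rowInsert_eq_cons {x y : ℤ} {r : List ℤ} (h : (rowInsert x r).2 = some y) :
    ∃ e s, (rowInsert x r).1 = e :: s ∧ e ≤ x ∧ (e = x ∨ e ∈ r) := by
  cases r with
  | nil => simp [rowInsert] at h
  | cons k r =>
    rcases lt_or_ge x k with hxk | hkx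
    · exact ⟨x, r, by rw [rowInsert_cons_of_lt hxk], le_rfl, .inl rfl⟩
    · exact ⟨k, _, by rw [rowInsert_cons_of_le hkx], hkx, .inr (by simp)⟩

theorem placticEquiv_rowInsert {x y : ℤ} {r : List ℤ} (hr : r.Pairwise (· ≤ ·))
    (h : (rowInsert x r).2 = some y) : PlacticEquiv (r ++ [x]) (y :: (rowInsert x r).1) := by
  induction r with
  | nil => simp [rowInsert] at h
  | cons k r ih =>
    rcases lt_or_ge x k with hxk | hkx
    · obtain rfl : k = y := by simpa [rowInsert_cons_of_lt hxk] using h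
      rw [rowInsert_cons_of_lt hxk]
      exact placticEquiv_cons_append_singleton hxk hr
    · rw [List.pairwise_cons] at hr
      rw [rowInsert_cons_of_le hkx] at h ⊢
      obtain ⟨e, s, hes, hex, he⟩ := exists_rowInsert_eq_cons h
      have hke : k ≤ e := he.elim (fun he => he ▸ hkx) (hr.1 e)
      have hyk : PlacticEquiv (k :: y :: e :: s) (y :: k :: e :: s) :=
        (Knuth.xzy hke (hex.trans_lt (lt_of_rowInsert h))).placticEquiv.append_right s
      exact ((ih hr.2 h).cons k).trans (by simpa only [hes] using hyk)

/-- The row word of a list of rows: `Tableau.word` for rows that need not form a tableau. -/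
def rowWord (T : List (List ℤ)) : List ℤ := T.reverse.flatten

@[simp] theorem rowWord_nil : rowWord [] = [] := rfl

@[simp] theorem rowWord_cons (r : List ℤ) (T : List (List ℤ)) :
    rowWord (r :: T) = rowWord T ++ r := by simp [rowWord]

theorem rowWord_append (S T : List (List ℤ)) : rowWord (S ++ T) = rowWord T ++ rowWord S := by
  simp [rowWord]

theorem mem_rowWord {x : ℤ} {T : List (List ℤ)} : x ∈ rowWord T ↔ ∃ r ∈ T, x ∈ r := by
  simp [rowWord]

theorem placticEquiv_insertRows {T : List (List ℤ)} (hT : IsTableau T) (x : ℤ) :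
    PlacticEquiv (rowWord (insertRows x T)) (rowWord T ++ [x]) := by
  induction T generalizing x with
  | nil => exact .refl _
  | cons r rs ih =>
    obtain ⟨_, hr, _, hrs⟩ := isTableau_cons.1 hT
    simp only [insertRows, rowWord_cons, List.append_assoc]
    rcases h : (rowInsert x r).2 with _ | y
    · rw [rowInsert_eq_append h]
      exact .refl _
    · refine ((ih hrs y).append_right _).trans ?_
      rw [List.append_assoc]
      exact (placticEquiv_rowInsert hr h).symm.append_left _

theorem placticEquiv_insertWord {T : List (List ℤ)} (hT : IsTableau T) (w : List ℤ) :
    PlacticEquiv (rowWord (insertWord T w)) (rowWord T ++ w) := by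
  induction w generalizing T with
  | nil => simpa using PlacticEquiv.refl _
  | cons x w ih =>
    simpa using (ih (hT.insertRows x)).trans ((placticEquiv_insertRows hT x).append_right w)

theorem rowWord_insertRows_perm (x : ℤ) (T : List (List ℤ)) :
    (rowWord (insertRows x T)).Perm (x :: rowWord T) := by
  induction T generalizing x with
  | nil => simp [insertRows, rowWord]
  | cons r rs ih =>
    have hrow := rowInsert_perm x r
    simp only [insertRows, rowWord_cons]
    rcases h : (rowInsert x r).2 with _ | y
    · rw [h] at hrow
      exact (hrow.append_left _).trans List.perm_middle
    · rw [h] at hrow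
      have hrows : (rowWord rs ++ y :: (rowInsert x r).1).Perm (rowWord rs ++ x :: r) :=
        hrow.append_left _
      exact ((ih y).append_right _).trans
        (List.perm_middle.symm.trans (hrows.trans List.perm_middle))

theorem rowWord_insertWord_perm (T : List (List ℤ)) (w : List ℤ) :
    (rowWord (insertWord T w)).Perm (w ++ rowWord T) := by
  induction w generalizing T with
  | nil => simp
  | cons x w ih =>
    exact (ih _).trans (((rowWord_insertRows_perm x T).append_left w).trans List.perm_middle)

/-! ### Rows placed side by side -/

theorem ColLT.length_le : ∀ {r s : List ℤ}, ColLT r s → s.length ≤ r.length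
  | _, [], _ => by simp
  | [], _ :: _, h => by simp [ColLT] at h
  | _ :: _, _ :: _, h => by simpa using h.2.length_le

theorem ColLT.eq_nil {s : List ℤ} (h : ColLT [] s) : s = [] :=
  List.length_eq_zero_iff.1 (Nat.le_zero.1 h.length_le)

theorem ColLT.exists_lt : ∀ {r s : List ℤ}, ColLT r s → ∀ y ∈ s, ∃ x ∈ r, x < y
  | _, [], _, _, hy => by simp at hy
  | [], _ :: _, h, _, _ => by simp [ColLT] at h
  | x :: _, _ :: _, h, y, hy => by
    rcases List.mem_cons.1 hy with rfl | hy
    · exact ⟨x, by simp, h.1⟩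
    · obtain ⟨w, hw, hwy⟩ := h.2.exists_lt y hy
      exact ⟨w, List.mem_cons_of_mem x hw, hwy⟩

theorem rowInsertWord_of_colLT_take {x q : List ℤ} (hx : x.Pairwise (· ≤ ·))
    (h : ColLT x (q.take x.length)) :
    rowInsertWord q x = (x ++ q.drop x.length, q.take x.length) := by
  induction x generalizing q with
  | nil => simp [rowInsertWord]
  | cons a x ih =>
    rw [List.pairwise_cons] at hx
    cases q with
    | nil =>
      have hxnil := ih (q := []) hx.2 (by simp [ColLT])
      simp [rowInsertWord, rowInsert, rowInsertWord_cons_of_le hx.1, hxnil]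
    | cons b q =>
      simp only [List.length_cons, List.take_succ_cons, ColLT] at h
      simp [rowInsertWord, rowInsert_cons_of_lt h.1, rowInsertWord_cons_of_le hx.1, ih hx.2 h.2]

theorem rowInsertWord_nil_left {x : List ℤ} (hx : x.Pairwise (· ≤ ·)) :
    rowInsertWord [] x = (x, []) := by
  simpa using rowInsertWord_of_colLT_take (q := []) hx (by simp [ColLT])

theorem rowInsertWord_of_colLT {x q : List ℤ} (hx : x.Pairwise (· ≤ ·)) (h : ColLT x q) :
    rowInsertWord q x = (x, q) := by
  have htake : q.take x.length = q := List.take_of_length_le h.length_le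
  have hdrop : q.drop x.length = [] := List.drop_of_length_le h.length_le
  rw [rowInsertWord_of_colLT_take hx (htake.symm ▸ h), htake, hdrop, List.append_nil]

/-- The rows of two lists of rows put next to each other; where one list is shorter, the remaining
rows of the other are kept. -/
def glueRows : List (List ℤ) → List (List ℤ) → List (List ℤ)
  | [], P => P
  | L, [] => L
  | l :: L, p :: P => (l ++ p) :: glueRows L P

/-- Each entry of a row of `L` is at most each entry of the same row of `P`, so that `glueRows L P`
has weakly increasing rows if `L` and `P` have. -/
def RowLE : List (List ℤ) → List (List ℤ) → Prop
  | [], _ => True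
  | _, [] => True
  | l :: L, p :: P => (∀ x ∈ l, ∀ y ∈ p, x ≤ y) ∧ RowLE L P

@[simp] theorem glueRows_nil_left (P : List (List ℤ)) : glueRows [] P = P := by
  cases P <;> rfl

@[simp] theorem glueRows_nil_right (L : List (List ℤ)) : glueRows L [] = L := by
  cases L <;> rfl

@[simp] theorem rowLE_nil_left (P : List (List ℤ)) : RowLE [] P := by
  cases P <;> trivial

@[simp] theorem rowLE_nil_right (L : List (List ℤ)) : RowLE L [] := by
  cases L <;> trivial

theorem RowLE.tail_right {L P : List (List ℤ)} {x : List ℤ} (hP : IsTableau (x :: P))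
    (h : RowLE L (x :: P)) : RowLE L P := by
  induction P generalizing L x with
  | nil => simp
  | cons p P ih =>
    cases L with
    | nil => simp
    | cons l L =>
      obtain ⟨_, _, hx, hP⟩ := isTableau_cons.1 hP
      refine ⟨fun u hu v hv => ?_, ih hP h.2⟩
      obtain ⟨w, hw, hwv⟩ := (hx p (by simp)).exists_lt v hv
      exact (h.1 u hu w hw).trans hwv.le

theorem insertWord_glueRows {L P : List (List ℤ)} {x : List ℤ} (hP : IsTableau (x :: P))
    (h : RowLE L (x :: P)) : insertWord (glueRows L P) x = glueRows L (x :: P) := by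
  induction P generalizing L x with
  | nil =>
    obtain ⟨hne, hx, _, _⟩ := isTableau_cons.1 hP
    cases L with
    | nil => simp [insertWord_nil_rows hne, rowInsertWord_nil_left hx]
    | cons l L =>
      have hrow := rowInsertWord_append_of_le h.1 []
      rw [List.append_nil, rowInsertWord_nil_left hx] at hrow
      simp [glueRows, insertWord_rows_cons, hrow]
  | cons p P ih =>
    obtain ⟨_, hx, hcol, hP⟩ := isTableau_cons.1 hP
    have hrow : rowInsertWord p x = (x, p) := rowInsertWord_of_colLT hx (hcol p (by simp))
    cases L with
    | nil =>
      have hP' : insertWord P p = p :: P := by simpa using ih (L := []) hP (by simp)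
      simp [insertWord_rows_cons, hrow, hP']
    | cons l L =>
      simp only [glueRows, insertWord_rows_cons, rowInsertWord_append_of_le h.1, hrow, ih hP h.2]

theorem insertWord_rowWord {L P : List (List ℤ)} (hP : IsTableau P) (h : RowLE L P) :
    insertWord L (rowWord P) = glueRows L P := by
  induction P generalizing L with
  | nil => simp
  | cons x P ih =>
    rw [rowWord_cons, insertWord_append, ih (isTableau_cons.1 hP).2.2.2 (h.tail_right hP),
      insertWord_glueRows hP h]

theorem insertWord_nil_rowWord {P : List (List ℤ)} (hP : IsTableau P) :
    insertWord [] (rowWord P) = P := by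
  rw [insertWord_rowWord hP (by simp), glueRows_nil_left]

/-! ### The semigroup of tableaux -/

namespace Tableau

theorem word_eq (T : Tableau) : T.word = rowWord T.rows := rfl

theorem mul_rows (T U : Tableau) : (T * U).rows = insertWord T.rows (rowWord U.rows) := rfl

@[simp] theorem empty_rows : (∅ : Tableau).rows = [] := rfl

theorem placticEquiv_mul (T U : Tableau) :
    PlacticEquiv (rowWord (T * U).rows) (rowWord T.rows ++ rowWord U.rows) :=
  placticEquiv_insertWord T.isTableau _

instance : Semigroup Tableau where
  mul_assoc T U V := by
    ext1
    simpa only [mul_rows, insertWord_append] using (placticEquiv_mul U V T.rows T.isTableau).symm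

@[simp] theorem mul_empty (T : Tableau) : T * ∅ = T := rfl

@[simp] theorem empty_mul (T : Tableau) : ∅ * T = T :=
  Tableau.ext (insertWord_nil_rowWord T.isTableau)

/-- The tableau obtained by inserting a word in the empty tableau. -/
def ofWord (w : List ℤ) : Tableau := ⟨insertWord [] w, isTableau_nil.insertWord w⟩

theorem ofWord_rows (w : List ℤ) : (ofWord w).rows = insertWord [] w := rfl

theorem ofWord_rowWord (T : Tableau) : ofWord (rowWord T.rows) = T :=
  Tableau.ext (insertWord_nil_rowWord T.isTableau)

theorem mul_ofWord_rows (T : Tableau) (w : List ℤ) :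
    (T * ofWord w).rows = insertWord T.rows w := by
  rw [mul_rows, ofWord_rows]
  simpa using placticEquiv_insertWord isTableau_nil w T.rows T.isTableau

theorem ofWord_append (u w : List ℤ) : ofWord (u ++ w) = ofWord u * ofWord w := by
  ext1
  rw [mul_ofWord_rows, ofWord_rows, ofWord_rows, insertWord_append]

theorem ofWord_eq_of_placticEquiv {u w : List ℤ} (h : PlacticEquiv u w) : ofWord u = ofWord w :=
  Tableau.ext (h [] isTableau_nil)

@[simp] theorem ofWord_nil : ofWord [] = ∅ := rfl

theorem word_mul_perm (T U : Tableau) : (T * U).word.Perm (U.word ++ T.word) :=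
  rowWord_insertWord_perm _ _

theorem mem_word_mul {T U : Tableau} {x : ℤ} : x ∈ (T * U).word ↔ x ∈ T.word ∨ x ∈ U.word := by
  rw [(word_mul_perm T U).mem_iff, List.mem_append, or_comm]

theorem length_word_mul (T U : Tableau) :
    (T * U).word.length = T.word.length + U.word.length := by
  rw [(word_mul_perm T U).length_eq, List.length_append, add_comm]

theorem eq_empty_of_word_eq_nil {T : Tableau} (h : T.word = []) : T = ∅ := by
  rw [← ofWord_rowWord T, ← word_eq, h, ofWord_nil]

theorem eq_empty_of_mul_eq_empty {T U : Tableau} (h : T * U = ∅) : T = ∅ ∧ U = ∅ := by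
  have hlen : 0 = T.word.length + U.word.length := by rw [← length_word_mul, h]; rfl
  exact ⟨eq_empty_of_word_eq_nil (List.length_eq_zero_iff.1 (by omega)),
    eq_empty_of_word_eq_nil (List.length_eq_zero_iff.1 (by omega))⟩

end Tableau

/-! ### Cuts along rows and columns -/

theorem filter_ne_nil_eq_self {l : List (List ℤ)} (h : ∀ r ∈ l, r ≠ []) :
    l.filter (· ≠ []) = l := List.filter_eq_self.2 fun r hr => by simpa using h r hr

theorem filter_ne_nil_eq_nil {l : List (List ℤ)} (h : ∀ r ∈ l, r = []) :
    l.filter (· ≠ []) = [] := List.filter_eq_nil_iff.2 fun r hr => by simpa using h r hr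

theorem exists_eq_filter_ne_nil_append_replicate {l : List (List ℤ)} (h : l.Pairwise ColLT) :
    ∃ k, l = l.filter (· ≠ []) ++ List.replicate k [] := by
  induction l with
  | nil => exact ⟨0, rfl⟩
  | cons r l ih =>
    rw [List.pairwise_cons] at h
    by_cases hr : r = []
    · subst hr
      have hnil : ∀ s ∈ [] :: l, s = [] :=
        List.forall_mem_cons.2 ⟨rfl, fun s hs => (h.1 s hs).eq_nil⟩
      refine ⟨(l.length + 1), ?_⟩
      rw [filter_ne_nil_eq_nil hnil]
      exact List.eq_replicate_of_mem hnil
    · obtain ⟨k, hk⟩ := ih h.2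
      refine ⟨k, ?_⟩
      rw [List.filter_cons_of_pos (by simpa using hr), List.cons_append, ← hk]

theorem filter_ne_nil_take {l : List (List ℤ)} (h : l.Pairwise ColLT) (a : ℕ) :
    (l.take a).filter (· ≠ []) = (l.filter (· ≠ [])).take a := by
  obtain ⟨k, hk⟩ := exists_eq_filter_ne_nil_append_replicate h
  conv_lhs => rw [hk, List.take_append, List.take_replicate, List.filter_append]
  rw [filter_ne_nil_eq_nil (l := List.replicate _ _) fun _ => List.eq_of_mem_replicate,
    filter_ne_nil_eq_self fun r hr => ?_, List.append_nil]
  simpa using (List.mem_filter.1 (List.mem_of_mem_take hr)).2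

theorem filter_ne_nil_drop {l : List (List ℤ)} (h : l.Pairwise ColLT) (a : ℕ) :
    (l.drop a).filter (· ≠ []) = (l.filter (· ≠ [])).drop a := by
  obtain ⟨k, hk⟩ := exists_eq_filter_ne_nil_append_replicate h
  conv_lhs => rw [hk, List.drop_append, List.drop_replicate, List.filter_append]
  rw [filter_ne_nil_eq_nil (l := List.replicate _ _) fun _ => List.eq_of_mem_replicate,
    filter_ne_nil_eq_self fun r hr => ?_, List.append_nil]
  simpa using (List.mem_filter.1 (List.mem_of_mem_drop hr)).2

theorem filter_ne_nil_map_filter (l : List (List ℤ)) {f : List ℤ → List ℤ} (hf : f [] = []) :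
    ((l.filter (· ≠ [])).map f).filter (· ≠ []) = (l.map f).filter (· ≠ []) := by
  induction l with
  | nil => rfl
  | cons r l ih =>
    by_cases hr : r = []
    · subst hr
      rw [List.filter_cons_of_neg (by simp), ih, List.map_cons, hf,
        List.filter_cons_of_neg (by simp)]
    · rw [List.filter_cons_of_pos (by simpa using hr), List.map_cons, List.map_cons,
        List.filter_cons, List.filter_cons, ih]

namespace Tableau

theorem top_rows (a : ℕ) (T : Tableau) : (T.top a).rows = T.rows.take a := rfl

theorem below_rows (a : ℕ) (T : Tableau) : (T.below a).rows = T.rows.drop a := rfl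

theorem left_rows (b : ℕ) (T : Tableau) :
    (T.left b).rows = (T.rows.map (List.take b)).filter (· ≠ []) := rfl

theorem right_rows (b : ℕ) (T : Tableau) :
    (T.right b).rows = (T.rows.map (List.drop b)).filter (· ≠ []) := rfl

@[simp] theorem below_empty (a : ℕ) : (∅ : Tableau).below a = ∅ :=
  Tableau.ext (by simp [below_rows])

@[simp] theorem right_empty (b : ℕ) : (∅ : Tableau).right b = ∅ := rfl

@[simp] theorem left_zero (T : Tableau) : T.left 0 = ∅ :=
  Tableau.ext (filter_ne_nil_eq_nil (by simp))

@[simp] theorem right_zero (T : Tableau) : T.right 0 = T := by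
  ext1
  rw [right_rows, show List.drop 0 = (id : List ℤ → List ℤ) from rfl, List.map_id]
  exact filter_ne_nil_eq_self T.isTableau.ne_nil

theorem left_rows_of_pos {b : ℕ} (hb : 0 < b) (T : Tableau) :
    (T.left b).rows = T.rows.map (List.take b) := by
  refine filter_ne_nil_eq_self fun r hr => ?_
  obtain ⟨s, hs, rfl⟩ := List.mem_map.1 hr
  simpa using ⟨hb.ne', T.isTableau.ne_nil s hs⟩

theorem left_top (a b : ℕ) (T : Tableau) : (T.top a).left b = (T.left b).top a := by
  ext1
  rw [left_rows, top_rows, top_rows, left_rows, List.map_take,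
    filter_ne_nil_take (T.isTableau.col_strict.map _ fun _ _ h => h.take b)]

theorem left_below (a b : ℕ) (T : Tableau) : (T.below a).left b = (T.left b).below a := by
  ext1
  rw [left_rows, below_rows, below_rows, left_rows, List.map_drop,
    filter_ne_nil_drop (T.isTableau.col_strict.map _ fun _ _ h => h.take b)]

theorem right_top (a b : ℕ) (T : Tableau) : (T.top a).right b = (T.right b).top a := by
  ext1
  rw [right_rows, top_rows, top_rows, right_rows, List.map_take,
    filter_ne_nil_take (T.isTableau.col_strict.map _ fun _ _ h => h.drop b)]

theorem right_below (a b : ℕ) (T : Tableau) : (T.below a).right b = (T.right b).below a := by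
  ext1
  rw [right_rows, below_rows, below_rows, right_rows, List.map_drop,
    filter_ne_nil_drop (T.isTableau.col_strict.map _ fun _ _ h => h.drop b)]

theorem left_left {b c : ℕ} (h : b ≤ c) (T : Tableau) : (T.left c).left b = T.left b := by
  ext1
  rw [left_rows, left_rows, filter_ne_nil_map_filter _ (by simp), List.map_map, left_rows]
  congr 2
  funext r
  simp [List.take_take, h]

theorem right_right (b c : ℕ) (T : Tableau) : (T.right b).right c = T.right (b + c) := by
  ext1
  rw [right_rows, right_rows, filter_ne_nil_map_filter _ (by simp), List.map_map, right_rows]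
  congr 2
  funext r
  simp

theorem right_left (b c : ℕ) (T : Tableau) :
    (T.left (b + c)).right b = (T.right b).left c := by
  ext1
  rw [right_rows, left_rows, filter_ne_nil_map_filter _ (by simp), List.map_map, left_rows,
    right_rows, filter_ne_nil_map_filter _ (by simp), List.map_map]
  congr 2
  funext r
  simp [List.drop_take]

@[simp] theorem right_left_self (b : ℕ) (T : Tableau) : (T.left b).right b = ∅ := by
  simpa using right_left b 0 T

@[simp] theorem left_left_self (b : ℕ) (T : Tableau) : (T.left b).left b = T.left b :=
  left_left le_rfl T

theorem top_top {a c : ℕ} (h : a ≤ c) (T : Tableau) : (T.top c).top a = T.top a := by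
  ext1; simp [top_rows, List.take_take, h]

@[simp] theorem below_top_self (a : ℕ) (T : Tableau) : (T.top a).below a = ∅ := by
  ext1; simp [top_rows, below_rows]

@[simp] theorem below_mul_top (a : ℕ) (T : Tableau) : T.below a * T.top a = T := by
  rw [← ofWord_rowWord (T.below a), ← ofWord_rowWord (T.top a), ← ofWord_append, below_rows,
    top_rows, ← rowWord_append, List.take_append_drop, ofWord_rowWord]

theorem below_eq_mul {a c : ℕ} (h : a ≤ c) (T : Tableau) :
    T.below a = T.below c * (T.top c).below a := by
  rw [← below_mul_top (c - a) (T.below a)]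
  congr 1
  · ext1; simp [below_rows, h]
  · ext1; simp [below_rows, top_rows, List.drop_take]

theorem mem_of_mem_word_below {a : ℕ} {T : Tableau} {x : ℤ} (h : x ∈ (T.below a).word) :
    x ∈ T.word := by
  rw [← below_mul_top a T]
  exact mem_word_mul.2 (.inl h)

end Tableau

/-! ### Tableaux side by side -/

/-- `R` fits to the right of `L` from column `b` on: `L` has at most `b` columns, and the rows of
`L` that have a row of `R` next to them have length `b` and no entry larger than an entry of that
row. -/
def Beside (b : ℕ) : List (List ℤ) → List (List ℤ) → Prop
  | L, [] => ∀ l ∈ L, l.length ≤ b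
  | [], _ :: _ => False
  | l :: L, r :: R => l.length = b ∧ (∀ x ∈ l, ∀ y ∈ r, x ≤ y) ∧ Beside b L R

theorem beside_nil_right {b : ℕ} {L : List (List ℤ)} :
    Beside b L [] ↔ ∀ l ∈ L, l.length ≤ b := by cases L <;> rfl

theorem Beside.length_le {b : ℕ} : ∀ {L R : List (List ℤ)}, Beside b L R → ∀ l ∈ L, l.length ≤ b
  | _, [], h => beside_nil_right.1 h
  | [], _ :: _, _ => by simp
  | _ :: _, _ :: _, h => List.forall_mem_cons.2 ⟨h.1.le, h.2.2.length_le⟩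

theorem Beside.rowLE {b : ℕ} : ∀ {L R : List (List ℤ)}, Beside b L R → RowLE L R
  | _, [], _ => by simp
  | [], _ :: _, _ => by simp
  | _ :: _, _ :: _, h => ⟨h.2.1, h.2.2.rowLE⟩

theorem Beside.map_take_glueRows {b : ℕ} :
    ∀ {L R : List (List ℤ)}, Beside b L R → (glueRows L R).map (List.take b) = L
  | L, [], h => by
    rw [glueRows_nil_right]
    exact (List.map_congr_left fun l hl => List.take_of_length_le (h.length_le l hl)).trans
      (List.map_id L)
  | [], _ :: _, h => h.elim
  | l :: L, r :: R, h => by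
    obtain ⟨rfl, _, h⟩ := h
    simp [glueRows, h.map_take_glueRows]

theorem Beside.filter_map_drop_glueRows {b : ℕ} :
    ∀ {L R : List (List ℤ)}, Beside b L R → (∀ r ∈ R, r ≠ []) →
      ((glueRows L R).map (List.drop b)).filter (· ≠ []) = R
  | L, [], h, _ => by
    rw [glueRows_nil_right]
    refine filter_ne_nil_eq_nil fun r hr => ?_
    obtain ⟨l, hl, rfl⟩ := List.mem_map.1 hr
    exact List.drop_of_length_le (h.length_le l hl)
  | [], _ :: _, h, _ => h.elim
  | l :: L, r :: R, h, hR => by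
    obtain ⟨rfl, _, h⟩ := h
    rw [List.forall_mem_cons] at hR
    rw [glueRows, List.map_cons, List.drop_left, List.filter_cons_of_pos (by simpa using hR.1),
      h.filter_map_drop_glueRows hR.2]

/-- `R` has at least as many rows as `S`, and each entry of a row of `S` is bounded below by an
entry of the same row of `R`. What fits to the left of `R` then also fits to the left of `S`. -/
def HeadLE : List (List ℤ) → List (List ℤ) → Prop
  | _, [] => True
  | [], _ :: _ => False
  | r :: R, s :: S => (∀ y ∈ s, ∃ x ∈ r, x ≤ y) ∧ HeadLE R S

theorem HeadLE.refl : ∀ R : List (List ℤ), HeadLE R R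
  | [] => trivial
  | _ :: R => ⟨fun y hy => ⟨y, hy, le_rfl⟩, HeadLE.refl R⟩

theorem HeadLE.trans : ∀ {R S U : List (List ℤ)}, HeadLE R S → HeadLE S U → HeadLE R U
  | _, _, [], _, _ => by simp [HeadLE]
  | _, [], _ :: _, _, h => by simp [HeadLE] at h
  | [], _ :: _, _ :: _, h, _ => by simp [HeadLE] at h
  | r :: R, s :: S, u :: U, h, h' =>
    ⟨fun z hz => by
      obtain ⟨y, hy, hyz⟩ := h'.1 z hz
      obtain ⟨x, hx, hxy⟩ := h.1 y hy
      exact ⟨x, hx, hxy.trans hyz⟩, h.2.trans h'.2⟩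

theorem Beside.mono {b : ℕ} : ∀ {L R S : List (List ℤ)}, Beside b L R → HeadLE R S → Beside b L S
  | _, _, [], h, _ => beside_nil_right.2 h.length_le
  | _, [], _ :: _, _, h => by simp [HeadLE] at h
  | [], _ :: _, _ :: _, h, _ => h.elim
  | _ :: _, _ :: _, _ :: _, h, h' =>
    ⟨h.1, fun x hx y hy => by
      obtain ⟨z, hz, hzy⟩ := h'.1 y hy
      exact (h.2.1 x hx z hz).trans hzy, h.2.2.mono h'.2⟩

theorem Beside.append {b : ℕ} {S : List (List ℤ)} (hS : ∀ l ∈ S, l.length ≤ b) :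
    ∀ {L R : List (List ℤ)}, Beside b L R → Beside b (L ++ S) R
  | _, [], h => beside_nil_right.2 fun l hl => (List.mem_append.1 hl).elim (h.length_le l) (hS l)
  | [], _ :: _, h => h.elim
  | _ :: _, _ :: _, h => ⟨h.1, h.2.1, h.2.2.append hS⟩

theorem exists_mem_rowInsert_le (x : ℤ) {y : ℤ} {r : List ℤ} (hy : y ∈ r) :
    ∃ z ∈ (rowInsert x r).1, z ≤ y := by
  induction r with
  | nil => simp at hy
  | cons k r ih =>
    rcases lt_or_ge x k with hxk | hkx
    · rw [rowInsert_cons_of_lt hxk]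
      rcases List.mem_cons.1 hy with rfl | hy
      exacts [⟨x, by simp, hxk.le⟩, ⟨y, by simp [hy], le_rfl⟩]
    · rw [rowInsert_cons_of_le hkx]
      rcases List.mem_cons.1 hy with rfl | hy
      · exact ⟨y, by simp, le_rfl⟩
      · obtain ⟨z, hz, hzy⟩ := ih hy
        exact ⟨z, List.mem_cons_of_mem k hz, hzy⟩

theorem headLE_insertRows (x : ℤ) (T : List (List ℤ)) : HeadLE (insertRows x T) T := by
  induction T generalizing x with
  | nil => trivial
  | cons r rs ih =>
    refine ⟨fun y hy => exists_mem_rowInsert_le x hy, ?_⟩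
    rcases (rowInsert x r).2 with _ | y
    · exact .refl _
    · exact ih y

theorem headLE_insertWord (T : List (List ℤ)) (w : List ℤ) : HeadLE (insertWord T w) T := by
  induction w generalizing T with
  | nil => exact .refl _
  | cons x w ih => exact (ih _).trans (headLE_insertRows x T)

theorem beside_map_take_filter_map_drop (b : ℕ) {rows : List (List ℤ)} (h : IsTableau rows) :
    Beside b (rows.map (List.take b)) ((rows.map (List.drop b)).filter (· ≠ [])) := by
  induction rows with
  | nil => simp [Beside]
  | cons r rs ih =>
    obtain ⟨_, hr, hcol, hrs⟩ := isTableau_cons.1 h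
    rcases le_or_gt r.length b with hlen | hlen
    · have hnil : ((r :: rs).map (List.drop b)).filter (· ≠ []) = [] := by
        refine filter_ne_nil_eq_nil (List.forall_mem_map.2 (List.forall_mem_cons.2 ?_))
        exact ⟨List.drop_of_length_le hlen,
          fun s hs => List.drop_of_length_le ((hcol s hs).length_le.trans hlen)⟩
      rw [hnil, beside_nil_right, List.forall_mem_map]
      exact fun s _ => List.length_take_le b s
    · have hdrop : r.drop b ≠ [] := by simpa using hlen
      rw [List.map_cons, List.map_cons, List.filter_cons_of_pos (by simpa using hdrop)]
      rw [← List.take_append_drop b r, List.pairwise_append] at hr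
      exact ⟨List.length_take_of_le hlen.le, hr.2.2, ih hrs⟩

theorem glueRows_map_take_filter_map_drop (b : ℕ) {rows : List (List ℤ)}
    (h : rows.Pairwise ColLT) :
    glueRows (rows.map (List.take b)) ((rows.map (List.drop b)).filter (· ≠ [])) = rows := by
  induction rows with
  | nil => rfl
  | cons r rs ih =>
    rw [List.pairwise_cons] at h
    rcases le_or_gt r.length b with hlen | hlen
    · have hall : ∀ s ∈ r :: rs, s.length ≤ b :=
        List.forall_mem_cons.2 ⟨hlen, fun s hs => (h.1 s hs).length_le.trans hlen⟩
      rw [filter_ne_nil_eq_nil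
        (List.forall_mem_map.2 fun s hs => List.drop_of_length_le (hall s hs)), glueRows_nil_right]
      exact (List.map_congr_left fun s hs => List.take_of_length_le (hall s hs)).trans
        (List.map_id _)
    · have hdrop : r.drop b ≠ [] := by simpa using hlen
      rw [List.map_cons, List.map_cons, List.filter_cons_of_pos (by simpa using hdrop), glueRows,
        List.take_append_drop, ih h.2]

namespace Tableau

theorem mul_rows_of_beside {b : ℕ} {L R : Tableau} (h : Beside b L.rows R.rows) :
    (L * R).rows = glueRows L.rows R.rows := insertWord_rowWord R.isTableau h.rowLE

theorem left_mul_of_beside {b : ℕ} {L R : Tableau} (h : Beside b L.rows R.rows) :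
    (L * R).left b = L := by
  ext1
  rw [left_rows, mul_rows_of_beside h, h.map_take_glueRows,
    filter_ne_nil_eq_self L.isTableau.ne_nil]

theorem right_mul_of_beside {b : ℕ} {L R : Tableau} (h : Beside b L.rows R.rows) :
    (L * R).right b = R := by
  ext1
  rw [right_rows, mul_rows_of_beside h, h.filter_map_drop_glueRows R.isTableau.ne_nil]

theorem beside_left_right {b : ℕ} (hb : 0 < b) (T : Tableau) :
    Beside b (T.left b).rows (T.right b).rows := by
  rw [left_rows_of_pos hb, right_rows]
  exact beside_map_take_filter_map_drop b T.isTableau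

@[simp] theorem left_mul_right (b : ℕ) (T : Tableau) : T.left b * T.right b = T := by
  rcases Nat.eq_zero_or_pos b with rfl | hb
  · rw [left_zero, right_zero, empty_mul]
  · ext1
    rw [mul_rows_of_beside (beside_left_right hb T), left_rows_of_pos hb, right_rows,
      glueRows_map_take_filter_map_drop b T.isTableau.col_strict]

theorem eq_of_left_right {S T : Tableau} (b : ℕ) (h : S.left b = T.left b)
    (h' : S.right b = T.right b) : S = T := by
  rw [← left_mul_right b S, h, h', left_mul_right]

theorem right_eq_mul {b c : ℕ} (h : b ≤ c) (T : Tableau) :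
    T.right b = (T.left c).right b * T.right c := by
  obtain ⟨d, rfl⟩ := Nat.exists_eq_add_of_le h
  rw [right_left, ← right_right, left_mul_right]

theorem mem_of_mem_word_left {b : ℕ} {T : Tableau} {x : ℤ} (h : x ∈ (T.left b).word) :
    x ∈ T.word := by
  rw [← left_mul_right b T]
  exact mem_word_mul.2 (.inl h)

theorem mem_of_mem_word_right {b : ℕ} {T : Tableau} {x : ℤ} (h : x ∈ (T.right b).word) :
    x ∈ T.word := by
  rw [← left_mul_right b T]
  exact mem_word_mul.2 (.inr h)

theorem beside_left_of_right_eq_mul {b : ℕ} (hb : 0 < b) {Q C E : Tableau}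
    (h : Q.right b = C * E) : Beside b (Q.left b).rows C.rows := by
  have hbeside := beside_left_right hb Q
  rw [h] at hbeside
  exact hbeside.mono (headLE_insertWord C.rows (rowWord E.rows))

theorem left_left_mul_of_right_eq_mul {b : ℕ} {Q C E : Tableau} (h : Q.right b = C * E) :
    (Q.left b * C).left b = Q.left b := by
  rcases Nat.eq_zero_or_pos b with rfl | hb
  · simp only [left_zero]
  · exact left_mul_of_beside (beside_left_of_right_eq_mul hb h)

theorem right_left_mul_of_right_eq_mul {b : ℕ} {Q C E : Tableau} (h : Q.right b = C * E) :
    (Q.left b * C).right b = C := by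
  rcases Nat.eq_zero_or_pos b with rfl | hb
  · simp only [left_zero, right_zero, empty_mul]
  · exact right_mul_of_beside (beside_left_of_right_eq_mul hb h)

end Tableau

/-! ### Column insertion -/

/-- Column bumping in one column, read from top to bottom: if some entry is at least `x`, then `x`
replaces the topmost such entry, which is returned; otherwise `x` is put at the end of the column.
Multiplication by a letter from the left acts on the columns in this way. -/
def colInsert (x : ℤ) : List ℤ → List ℤ × Option ℤ
  | [] => ([x], none)
  | y :: c => if x ≤ y then (x :: c, some y) else (y :: (colInsert x c).1, (colInsert x c).2)

/-- The column `d` can stand to the right of the column `c`: the counterpart of `ColLT` for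
columns. -/
def ColLE : List ℤ → List ℤ → Prop
  | _, [] => True
  | [], _ :: _ => False
  | x :: c, y :: d => x ≤ y ∧ ColLE c d

theorem colInsert_cons_of_le {x k : ℤ} (hx : x ≤ k) (c : List ℤ) :
    colInsert x (k :: c) = (x :: c, some k) := by
  simp [colInsert, hx]

theorem colInsert_cons_of_lt {x k : ℤ} (hx : k < x) (c : List ℤ) :
    colInsert x (k :: c) = (k :: (colInsert x c).1, (colInsert x c).2) := by
  simp [colInsert, hx.not_ge]

theorem le_of_colInsert {x y : ℤ} {c : List ℤ} (h : (colInsert x c).2 = some y) : x ≤ y := by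
  induction c with
  | nil => simp [colInsert] at h
  | cons k c ih =>
    rcases le_or_gt x k with hxk | hkx
    · simp_all [colInsert_cons_of_le hxk]
    · exact ih (by simpa [colInsert_cons_of_lt hkx] using h)

theorem ColLE.colInsert_left (x : ℤ) : ∀ {c d : List ℤ}, ColLE c d → ColLE (colInsert x c).1 d
  | _, [], _ => by simp [ColLE]
  | [], _ :: _, h => by simp [ColLE] at h
  | k :: c, l :: d, h => by
    rcases le_or_gt x k with hxk | hkx
    · rw [colInsert_cons_of_le hxk]
      exact ⟨hxk.trans h.1, h.2⟩
    · rw [colInsert_cons_of_lt hkx]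
      exact ⟨h.1, h.2.colInsert_left x⟩

theorem ColLE.colInsert_both {x y : ℤ} : ∀ {c d : List ℤ}, ColLE c d →
    (colInsert x c).2 = some y → ColLE (colInsert x c).1 (colInsert y d).1
  | [], _, _, h => by simp [colInsert] at h
  | k :: c, [], _, h => by
    have hxy := le_of_colInsert h
    rcases le_or_gt x k with hxk | hkx
    · rw [colInsert_cons_of_le hxk]
      exact ⟨hxy, by simp [ColLE]⟩
    · rw [colInsert_cons_of_lt hkx]
      exact ⟨hkx.le.trans hxy, by simp [ColLE]⟩
  | k :: c, l :: d, hcd, h => by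
    have hxy := le_of_colInsert h
    rcases le_or_gt x k with hxk | hkx
    · obtain rfl : k = y := by simpa [colInsert_cons_of_le hxk] using h
      rw [colInsert_cons_of_le hxk, colInsert_cons_of_le hcd.1]
      exact ⟨hxk, hcd.2⟩
    · rw [colInsert_cons_of_lt hkx] at h ⊢
      rcases le_or_gt y l with hyl | hly
      · rw [colInsert_cons_of_le hyl]
        exact ⟨hkx.le.trans hxy, hcd.2.colInsert_left x⟩
      · rw [colInsert_cons_of_lt hly]
        exact ⟨hcd.1, hcd.2.colInsert_both h⟩

theorem mem_colInsert {x z : ℤ} {c : List ℤ} (h : z ∈ (colInsert x c).1) : z = x ∨ z ∈ c := by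
  induction c with
  | nil => simpa [colInsert] using h
  | cons k c ih =>
    rcases le_or_gt x k with hxk | hkx
    · rw [colInsert_cons_of_le hxk] at h
      exact (List.mem_cons.1 h).imp_right (List.mem_cons_of_mem k)
    · rw [colInsert_cons_of_lt hkx] at h
      rcases List.mem_cons.1 h with rfl | h
      exacts [.inr (by simp), (ih h).imp_right (List.mem_cons_of_mem k)]

theorem colInsert_sorted (x : ℤ) {c : List ℤ} (h : c.Pairwise (· < ·)) :
    (colInsert x c).1.Pairwise (· < ·) := by
  induction c with
  | nil => simp [colInsert]
  | cons k c ih =>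
    rw [List.pairwise_cons] at h
    rcases le_or_gt x k with hxk | hkx
    · rw [colInsert_cons_of_le hxk]
      exact List.pairwise_cons.2 ⟨fun z hz => hxk.trans_lt (h.1 z hz), h.2⟩
    · rw [colInsert_cons_of_lt hkx]
      refine List.pairwise_cons.2 ⟨fun z hz => ?_, ih h.2⟩
      rcases mem_colInsert hz with rfl | hz
      exacts [hkx, h.1 z hz]

theorem colInsert_eq_append {x : ℤ} {c : List ℤ} (h : (colInsert x c).2 = none) :
    (colInsert x c).1 = c ++ [x] := by
  induction c with
  | nil => rfl
  | cons k c ih =>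
    rcases le_or_gt x k with hxk | hkx
    · simp [colInsert_cons_of_le hxk] at h
    · rw [colInsert_cons_of_lt hkx] at h ⊢
      rw [ih h, List.cons_append]

theorem exists_colInsert_eq_cons {x y : ℤ} {c : List ℤ} (h : (colInsert x c).2 = some y) :
    ∃ e s, (colInsert x c).1 = e :: s ∧ e ≤ x := by
  cases c with
  | nil => simp [colInsert] at h
  | cons k c =>
    rcases le_or_gt x k with hxk | hkx
    · exact ⟨x, c, by rw [colInsert_cons_of_le hxk], le_rfl⟩
    · exact ⟨k, _, by rw [colInsert_cons_of_lt hkx], hkx.le⟩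

theorem placticEquiv_cons_reverse_append {x d : ℤ} {c : List ℤ} (hx : x ≤ d)
    (hc : (d :: c).Pairwise (· < ·)) :
    PlacticEquiv (x :: (c.reverse ++ [d])) (c.reverse ++ [x, d]) := by
  induction c generalizing d with
  | nil => exact .refl _
  | cons k c ih =>
    rw [List.pairwise_cons] at hc
    have hdk : d < k := hc.1 k (by simp)
    have h₁ := (ih (hx.trans hdk.le) hc.2).append_right [d]
    have h₂ := (Knuth.xzy hx hdk).placticEquiv.append_left c.reverse
    simp only [List.reverse_cons, List.append_assoc, List.cons_append, List.nil_append] at h₁ h₂ ⊢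
    exact h₁.trans h₂

theorem placticEquiv_colInsert {x y : ℤ} {c : List ℤ} (hc : c.Pairwise (· < ·))
    (h : (colInsert x c).2 = some y) :
    PlacticEquiv (x :: c.reverse) ((colInsert x c).1.reverse ++ [y]) := by
  induction c with
  | nil => simp [colInsert] at h
  | cons d c ih =>
    rcases le_or_gt x d with hxd | hdx
    · obtain rfl : d = y := by simpa [colInsert_cons_of_le hxd] using h
      simpa [colInsert_cons_of_le hxd] using placticEquiv_cons_reverse_append hxd hc
    · have hsorted := colInsert_sorted x hc
      rw [colInsert_cons_of_lt hdx] at h hsorted ⊢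
      have h₁ := (ih (List.pairwise_cons.1 hc).2 h).append_right [d]
      obtain ⟨e, s, hes, hex⟩ := exists_colInsert_eq_cons h
      rw [hes] at h₁ hsorted ⊢
      have hde : d < e := (List.pairwise_cons.1 hsorted).1 e (by simp)
      have h₂ := (Knuth.yzx hde (hex.trans (le_of_colInsert h))).placticEquiv.append_left s.reverse
      simp only [List.reverse_cons, List.append_assoc, List.cons_append, List.nil_append] at h₁ h₂ ⊢
      exact h₁.trans h₂

theorem isTableau_column {c : List ℤ} (h : c.Pairwise (· < ·)) :
    IsTableau (c.map fun x => [x]) :=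
  ⟨by simp, by simp, h.map _ fun _ _ hxy => ⟨hxy, trivial⟩⟩

theorem rowWord_column (c : List ℤ) : rowWord (c.map fun x => [x]) = c.reverse := by
  induction c with
  | nil => rfl
  | cons x c ih => simp [ih]

theorem beside_column_iff : ∀ {c d : List ℤ},
    Beside 1 (c.map fun x => [x]) (d.map fun x => [x]) ↔ ColLE c d
  | _, [] => by simp [Beside, ColLE]
  | [], _ :: _ => by simp [Beside, ColLE]
  | x :: c, y :: d => by simp [Beside, ColLE, beside_column_iff (c := c) (d := d)]

theorem headLE_map_take (b : ℕ) (R : List (List ℤ)) : HeadLE R (R.map (List.take b)) := by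
  induction R with
  | nil => trivial
  | cons r R ih => exact ⟨fun y hy => ⟨y, List.mem_of_mem_take hy, le_rfl⟩, ih⟩

theorem IsTableau.headLE_map_take_one {R : List (List ℤ)} (h : IsTableau R) :
    HeadLE (R.map (List.take 1)) R := by
  induction R with
  | nil => trivial
  | cons r R ih =>
    obtain ⟨hne, hr, _, hR⟩ := isTableau_cons.1 h
    refine ⟨fun y hy => ?_, ih hR⟩
    obtain ⟨x, r, rfl⟩ := List.exists_cons_of_ne_nil hne
    refine ⟨x, by simp, ?_⟩
    rcases List.mem_cons.1 hy with rfl | hy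
    exacts [le_rfl, (List.pairwise_cons.1 hr).1 y hy]

namespace Tableau

/-- The tableau with the single column `c`. -/
def column (c : List ℤ) (h : c.Pairwise (· < ·)) : Tableau := ⟨_, isTableau_column h⟩

theorem column_eq_ofWord {c : List ℤ} (h : c.Pairwise (· < ·)) : column c h = ofWord c.reverse := by
  rw [← ofWord_rowWord (column c h), ← rowWord_column c]
  rfl

theorem exists_left_one_eq_column (T : Tableau) : ∃ c h, T.left 1 = column c h := by
  have exists_heads (rows : List (List ℤ)) (hne : ∀ r ∈ rows, r ≠ []) :
      ∃ c : List ℤ, rows.map (List.take 1) = c.map fun x => [x] := by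
    induction rows with
    | nil => exact ⟨[], rfl⟩
    | cons r rows ih =>
      rw [List.forall_mem_cons] at hne
      obtain ⟨c, hc⟩ := ih hne.2
      obtain ⟨x, r, rfl⟩ := List.exists_cons_of_ne_nil hne.1
      exact ⟨x :: c, by simp [hc]⟩
  obtain ⟨c, hc⟩ := exists_heads T.rows T.isTableau.ne_nil
  rw [← left_rows_of_pos one_pos] at hc
  have hcol := (T.left 1).isTableau.col_strict
  rw [hc, List.pairwise_map] at hcol
  exact ⟨c, hcol.imp And.left, Tableau.ext hc⟩

theorem length_word_right_lt {b : ℕ} {T : Tableau} (h : T.left b ≠ ∅) :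
    (T.right b).word.length < T.word.length := by
  have hpos : 0 < (T.left b).word.length :=
    List.length_pos_iff.2 fun hnil => h (eq_empty_of_word_eq_nil hnil)
  conv_rhs => rw [← left_mul_right b T, length_word_mul]
  omega

theorem ofWord_singleton_mul (x : ℤ) {T : Tableau} {c : List ℤ} {hc : c.Pairwise (· < ·)}
    (h : T.left 1 = column c hc) :
    ofWord [x] * T = column (colInsert x c).1 (colInsert_sorted x hc) *
      (ofWord (colInsert x c).2.toList * T.right 1) := by
  conv_lhs => rw [← left_mul_right 1 T, h]
  rw [← mul_assoc, ← mul_assoc, column_eq_ofWord, column_eq_ofWord, ← ofWord_append,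
    ← ofWord_append]
  congr 1
  rcases hy : (colInsert x c).2 with _ | y
  · rw [colInsert_eq_append hy]
    simp
  · exact ofWord_eq_of_placticEquiv (placticEquiv_colInsert hc hy)

theorem beside_colInsert (x : ℤ) {T : Tableau} {c : List ℤ} {hc : c.Pairwise (· < ·)}
    (h : T.left 1 = column c hc) :
    Beside 1 (column (colInsert x c).1 (colInsert_sorted x hc)).rows
      (ofWord (colInsert x c).2.toList * T.right 1).rows := by
  have hbeside := beside_left_right one_pos T
  rw [h] at hbeside
  rcases hy : (colInsert x c).2 with _ | y
  · simp only [Option.toList_none, ofWord_nil, empty_mul, column, colInsert_eq_append hy,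
      List.map_append]
    exact hbeside.append (by simp)
  · obtain ⟨d, hd, hd'⟩ := exists_left_one_eq_column (T.right 1)
    have hlt : (T.right 1).word.length < T.word.length := by
      refine length_word_right_lt fun hempty => ?_
      obtain rfl : c = [] := by simpa [column] using congrArg rows (h.symm.trans hempty)
      simp [colInsert] at hy
    have hcd : ColLE c d := by
      rw [← beside_column_iff]
      have := hbeside.mono (headLE_map_take 1 _)
      rwa [← left_rows_of_pos one_pos, hd'] at this
    have hleft : (ofWord [y] * T.right 1).left 1 =
        column (colInsert y d).1 (colInsert_sorted y hd) := by
      rw [ofWord_singleton_mul y hd', left_mul_of_beside (beside_colInsert y hd')]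
    have hhead := (ofWord [y] * T.right 1).isTableau.headLE_map_take_one
    rw [← left_rows_of_pos one_pos, hleft] at hhead
    exact (beside_column_iff.2 (hcd.colInsert_both hy)).mono hhead
termination_by T.word.length

theorem left_one_ofWord_singleton_mul (x : ℤ) {T : Tableau} {c : List ℤ}
    {hc : c.Pairwise (· < ·)} (h : T.left 1 = column c hc) :
    (ofWord [x] * T).left 1 = column (colInsert x c).1 (colInsert_sorted x hc) := by
  rw [ofWord_singleton_mul x h, left_mul_of_beside (beside_colInsert x h)]

theorem right_one_ofWord_singleton_mul (x : ℤ) {T : Tableau} {c : List ℤ}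
    {hc : c.Pairwise (· < ·)} (h : T.left 1 = column c hc) :
    (ofWord [x] * T).right 1 = ofWord (colInsert x c).2.toList * T.right 1 := by
  rw [ofWord_singleton_mul x h, right_mul_of_beside (beside_colInsert x h)]

theorem left_ofWord_singleton_mul (b : ℕ) (x : ℤ) (T : Tableau) :
    (ofWord [x] * T).left b = (ofWord [x] * T.left b).left b := by
  induction b generalizing x T with
  | zero => simp only [left_zero]
  | succ b ih =>
    obtain ⟨c, hc, hT⟩ := exists_left_one_eq_column T
    have hT' : (T.left (1 + b)).left 1 = column c hc := by rw [left_left (by omega), hT]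
    rw [add_comm b 1]
    apply eq_of_left_right 1
    · rw [left_left (by omega), left_left (by omega), left_one_ofWord_singleton_mul x hT,
        left_one_ofWord_singleton_mul x hT']
    · rw [right_left, right_left, right_one_ofWord_singleton_mul x hT,
        right_one_ofWord_singleton_mul x hT', right_left]
      rcases (colInsert x c).2 with _ | y
      · simp
      · exact ih y _

theorem right_ofWord_singleton_mul (b : ℕ) (x : ℤ) (T : Tableau) :
    (ofWord [x] * T).right b = (ofWord [x] * T.left b).right b * T.right b := by
  induction b generalizing x T with
  | zero => simp
  | succ b ih =>
    obtain ⟨c, hc, hT⟩ := exists_left_one_eq_column T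
    have hT' : (T.left (1 + b)).left 1 = column c hc := by rw [left_left (by omega), hT]
    rw [add_comm b 1, ← right_right, ← right_right, ← right_right,
      right_one_ofWord_singleton_mul x hT, right_one_ofWord_singleton_mul x hT', right_left]
    rcases (colInsert x c).2 with _ | y
    · simp
    · exact ih y _

theorem left_mul (b : ℕ) (A Q : Tableau) : (A * Q).left b = (A * Q.left b).left b := by
  rw [← ofWord_rowWord A]
  induction rowWord A.rows with
  | nil => simp
  | cons x w ih =>
    rw [show x :: w = [x] ++ w from rfl, ofWord_append, mul_assoc, mul_assoc,
      left_ofWord_singleton_mul, ih, ← left_ofWord_singleton_mul]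

theorem right_mul (b : ℕ) (A Q : Tableau) :
    (A * Q).right b = (A * Q.left b).right b * Q.right b := by
  rw [← ofWord_rowWord A]
  induction rowWord A.rows with
  | nil => simp
  | cons x w ih =>
    rw [show x :: w = [x] ++ w from rfl, ofWord_append, mul_assoc, mul_assoc,
      right_ofWord_singleton_mul, ih, right_ofWord_singleton_mul b x (ofWord w * Q.left b),
      left_mul, mul_assoc]

end Tableau

/-! ### Products and cuts along rows -/

theorem insertWord_take_drop (a : ℕ) {T : List (List ℤ)} (hT : IsTableau T) (w : List ℤ) :
    (insertWord T w).take a = (insertWord (T.take a) w).take a ∧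
      ∃ v, (insertWord T w).drop a = insertWord (T.drop a) v ∧
        (insertWord (T.take a) w).drop a = insertWord [] v := by
  induction a generalizing T w with
  | zero => exact ⟨by simp, w, by simp, by simp⟩
  | succ a ih =>
    cases T with
    | nil =>
      have h : IsTableau ((insertWord [] w).drop (a + 1)) :=
        (isTableau_nil.insertWord w).of_sublist (List.drop_sublist _ _)
      exact ⟨by simp, rowWord ((insertWord [] w).drop (a + 1)), by simp [insertWord_nil_rowWord h]⟩
    | cons r rs =>
      obtain ⟨htake, v, hv, hv'⟩ := ih (isTableau_cons.1 hT).2.2.2 (rowInsertWord r w).2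
      exact ⟨by simp [insertWord_rows_cons, htake], v, by simp [insertWord_rows_cons, hv],
        by simp [insertWord_rows_cons, hv']⟩

namespace Tableau

theorem top_mul (a : ℕ) (P B : Tableau) : (P * B).top a = (P.top a * B).top a :=
  Tableau.ext (insertWord_take_drop a P.isTableau (rowWord B.rows)).1

theorem below_mul (a : ℕ) (P B : Tableau) :
    (P * B).below a = P.below a * (P.top a * B).below a := by
  obtain ⟨_, v, hv, hv'⟩ := insertWord_take_drop a P.isTableau (rowWord B.rows)
  rw [show (P.top a * B).below a = ofWord v from Tableau.ext hv']
  ext1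
  rw [mul_ofWord_rows]
  exact hv

end Tableau

/-! ### Counting the entries of the first row -/

theorem countP_rowInsert (x m : ℤ) {r : List ℤ} (hr : r.Pairwise (· ≤ ·)) :
    (rowInsert x r).1.countP (· ≤ m) =
      if x ≤ m then max (r.countP (· ≤ m)) (r.countP (· ≤ x) + 1) else r.countP (· ≤ m) := by
  induction r with
  | nil => by_cases h : x ≤ m <;> simp [rowInsert, h]
  | cons k r ih =>
    rw [List.pairwise_cons] at hr
    have countP_eq_zero : ∀ n < k, r.countP (· ≤ n) = 0 := fun n hn =>
      List.countP_eq_zero.2 fun y hy => by simpa using hn.trans_le (hr.1 y hy)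
    rcases lt_or_ge x k with hxk | hkx
    · rw [rowInsert_cons_of_lt hxk]
      by_cases hkm : k ≤ m
      · simp [countP_eq_zero x hxk, hkm, hxk.le.trans hkm, hxk.not_ge]
      · simp [List.countP_cons, countP_eq_zero x hxk, countP_eq_zero m (not_le.1 hkm), hkm,
          hxk.not_ge]
    · rw [rowInsert_cons_of_le hkx]
      by_cases hxm : x ≤ m
      · simp only [List.countP_cons, ih hr.2, hxm, hkx, hkx.trans hxm, if_true, decide_true]
        omega
      · simp [List.countP_cons, ih hr.2, hxm]

theorem countP_rowInsertWord {c : ℤ → ℕ} (hc : Monotone c) (w : List ℤ) {r s : List ℤ}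
    (hr : r.Pairwise (· ≤ ·)) (hs : s.Pairwise (· ≤ ·))
    (h : ∀ m, s.countP (· ≤ m) ≤ r.countP (· ≤ m) ∧
      r.countP (· ≤ m) ≤ s.countP (· ≤ m) + c m) (m : ℤ) :
    (rowInsertWord s w).1.countP (· ≤ m) ≤ (rowInsertWord r w).1.countP (· ≤ m) ∧
      (rowInsertWord r w).1.countP (· ≤ m) ≤ (rowInsertWord s w).1.countP (· ≤ m) + c m := by
  induction w generalizing r s with
  | nil => exact h m
  | cons x _ ih =>
    refine ih (rowInsert_sorted x hr) (rowInsert_sorted x hs) fun n => ?_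
    rw [countP_rowInsert x n hr, countP_rowInsert x n hs]
    have hn := h n
    have hx := h x
    split_ifs with hxn
    · have := hc hxn
      omega
    · exact hn

/-- The first row of a list of rows, empty if there are no rows. -/
def firstRow (T : List (List ℤ)) : List ℤ := T.headD []

theorem IsTableau.firstRow_sorted {T : List (List ℤ)} (h : IsTableau T) :
    (firstRow T).Pairwise (· ≤ ·) := by
  cases T with
  | nil => simp [firstRow]
  | cons r T => exact (isTableau_cons.1 h).2.1

theorem firstRow_insertWord (T : List (List ℤ)) (w : List ℤ) :
    firstRow (insertWord T w) = (rowInsertWord (firstRow T) w).1 := by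
  cases T with
  | nil =>
    cases w with
    | nil => rfl
    | cons x w => rw [insertWord_nil_rows (by simp)]; rfl
  | cons r T => rw [insertWord_rows_cons]; rfl

theorem mem_of_mem_firstRow {T : List (List ℤ)} {x : ℤ} (h : x ∈ firstRow T) : x ∈ rowWord T := by
  cases T with
  | nil => simp [firstRow] at h
  | cons r T => exact mem_rowWord.2 ⟨r, by simp, h⟩

theorem Tableau.countP_firstRow_mul (U V : Tableau) (m : ℤ) :
    (firstRow V.rows).countP (· ≤ m) ≤ (firstRow (U * V).rows).countP (· ≤ m) ∧
      (firstRow (U * V).rows).countP (· ≤ m) ≤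
        (firstRow V.rows).countP (· ≤ m) + (firstRow U.rows).countP (· ≤ m) := by
  have hV : firstRow V.rows = (rowInsertWord [] (rowWord V.rows)).1 := by
    conv_lhs => rw [← insertWord_nil_rowWord V.isTableau, firstRow_insertWord]
    rfl
  have hmono : Monotone fun m => (firstRow U.rows).countP (· ≤ m) := fun m n hmn =>
    List.countP_mono_left fun x _ hx => by simp only [decide_eq_true_eq] at hx ⊢; omega
  rw [mul_rows, firstRow_insertWord, hV]
  exact countP_rowInsertWord hmono _ U.isTableau.firstRow_sorted (by simp) (by simp) m

theorem ColLT.countP_le (m : ℤ) :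
    ∀ {r s : List ℤ}, ColLT r s → s.countP (· ≤ m) ≤ r.countP (· < m)
  | _, [], _ => by simp
  | [], _ :: _, h => by simp [ColLT] at h
  | x :: r, y :: s, h => by
    have := h.2.countP_le m
    have := h.1
    simp only [List.countP_cons, decide_eq_true_eq]
    split_ifs <;> omega

theorem colLT_of_countP {p x : List ℤ} (hp : p.Pairwise (· ≤ ·)) (hx : x.Pairwise (· ≤ ·))
    (h : ∀ m ∈ x, x.countP (· ≤ m) ≤ p.countP (· < m)) : ColLT p x := by
  induction x generalizing p with
  | nil => simp [ColLT]
  | cons y s ih =>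
    rw [List.pairwise_cons] at hx
    have hpos : 0 < p.countP (· < y) := lt_of_lt_of_le (by simp) (h y (by simp))
    cases p with
    | nil => simp at hpos
    | cons z r =>
      rw [List.pairwise_cons] at hp
      have hzy : z < y := by
        obtain ⟨t, ht, hty⟩ := List.countP_pos_iff.1 hpos
        rw [decide_eq_true_eq] at hty
        rcases List.mem_cons.1 ht with rfl | ht
        exacts [hty, (hp.1 t ht).trans_lt hty]
      refine ⟨hzy, ih hp.2 hx.2 fun m hm => ?_⟩
      have hym := hx.1 m hm
      simpa [List.countP_cons, hym, hzy.trans_le hym] using h m (by simp [hm])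

/-! ### Tableaux on top of each other -/

theorem IsTableau.append {A X : List (List ℤ)} (hA : IsTableau A) (hX : IsTableau X)
    (h : ∀ p ∈ A, ColLT p (firstRow X)) : IsTableau (A ++ X) := by
  refine ⟨fun r hr => (List.mem_append.1 hr).elim (hA.ne_nil r) (hX.ne_nil r),
    fun r hr => (List.mem_append.1 hr).elim (hA.row_weak r) (hX.row_weak r),
    List.pairwise_append.2 ⟨hA.col_strict, hX.col_strict, fun p hp x hx => ?_⟩⟩
  cases X with
  | nil => simp at hx
  | cons y X =>
    rcases List.mem_cons.1 hx with rfl | hx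
    · exact h p hp
    · exact (h p hp).trans ((isTableau_cons.1 hX).2.2.1 x hx)

namespace Tableau

theorem mul_rows_of_isTableau_append {X A : Tableau} (h : IsTableau (A.rows ++ X.rows)) :
    (X * A).rows = A.rows ++ X.rows := by
  rw [← ofWord_rowWord X, ← ofWord_rowWord A, ← ofWord_append, ← rowWord_append,
    ofWord_rowWord, ofWord_rowWord, ofWord_rowWord ⟨_, h⟩]

theorem colLT_firstRow_below {a : ℕ} {P : Tableau} {p : List ℤ} (hp : p ∈ (P.top a).rows) :
    ColLT p (firstRow (P.below a).rows) := by
  have h := P.isTableau.col_strict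
  rw [top_rows] at hp
  rw [← List.take_append_drop a P.rows, List.pairwise_append] at h
  rw [below_rows]
  cases hd : P.rows.drop a with
  | nil => cases p <;> simp [firstRow, ColLT]
  | cons q d => exact h.2.2 p hp q (by simp [hd])

theorem mul_top_rows_of_below_eq_mul {a : ℕ} {P C E : Tableau} (h : P.below a = C * E) :
    (E * P.top a).rows = (P.top a).rows ++ E.rows :=
  mul_rows_of_isTableau_append <| (P.top a).isTableau.append E.isTableau fun p hp =>
    colLT_of_countP ((P.top a).isTableau.row_weak p hp) E.isTableau.firstRow_sorted fun m _ =>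
      (countP_firstRow_mul C E m).1.trans (h ▸ (colLT_firstRow_below hp).countP_le m)

theorem length_top_rows_or_eq_empty {a : ℕ} {P C E : Tableau} (h : P.below a = C * E) :
    (P.top a).rows.length = a ∨ E = ∅ := by
  rcases le_total a P.rows.length with hle | hle
  · exact .inl (by simpa [top_rows] using hle)
  · refine .inr (eq_empty_of_mul_eq_empty (T := C) (U := E) ?_).2
    rw [← h]
    ext1
    simpa [below_rows] using hle

theorem top_mul_top_of_below_eq_mul {a : ℕ} {P C E : Tableau} (h : P.below a = C * E) :
    (E * P.top a).top a = P.top a := by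
  rcases length_top_rows_or_eq_empty h with hlen | rfl
  · ext1
    rw [top_rows, mul_top_rows_of_below_eq_mul h, List.take_left' hlen]
  · simp [top_top]

theorem below_mul_top_of_below_eq_mul {a : ℕ} {P C E : Tableau} (h : P.below a = C * E) :
    (E * P.top a).below a = E := by
  rcases length_top_rows_or_eq_empty h with hlen | rfl
  · ext1
    rw [below_rows, mul_top_rows_of_below_eq_mul h, List.drop_left' hlen]
  · simp

end Tableau

/-! ### Products with a rectangle of small entries -/

theorem colLT_of_forall_lt : ∀ {r s : List ℤ}, s.length ≤ r.length →
    (∀ x ∈ r, ∀ y ∈ s, x < y) → ColLT r s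
  | _, [], _, _ => by simp [ColLT]
  | [], _ :: _, h, _ => by simp at h
  | x :: r, y :: s, h, h' => ⟨h' x (by simp) y (by simp),
      colLT_of_forall_lt (by simpa using h) fun u hu v hv => h' u (by simp [hu]) v (by simp [hv])⟩

theorem insertWord_cons_of_colLT_take {b : ℕ} {x s : List ℤ} (rows : List (List ℤ))
    (hx : x.Pairwise (· ≤ ·)) (hxb : x.length ≤ b) (hsb : s.drop b ≠ [] → x.length = b)
    (h : ColLT x (s.take b)) :
    (insertWord (s :: rows) x).map (List.take b) =
        x :: (insertWord rows (s.take b)).map (List.take b) ∧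
      (insertWord (s :: rows) x).map (List.drop b) =
        s.drop b :: (insertWord rows (s.take b)).map (List.drop b) := by
  rw [insertWord_rows_cons]
  by_cases hs : s.drop b = []
  · have hs_take : s.take b = s := List.take_of_length_le (List.drop_eq_nil_iff.1 hs)
    rw [hs_take] at h ⊢
    simp [rowInsertWord_of_colLT hx h, List.take_of_length_le hxb, List.drop_of_length_le hxb, hs]
  · obtain rfl := hsb hs
    simp [rowInsertWord_of_colLT_take hx h]

theorem insertWord_take_cut {b : ℕ} (hb : 0 < b) {q : List ℤ} {rows : List (List ℤ)}
    (h : IsTableau (q :: rows)) :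
    (insertWord rows (q.take b)).map (List.take b) = (q :: rows).map (List.take b) ∧
      ((insertWord rows (q.take b)).map (List.drop b)).filter (· ≠ []) =
        (rows.map (List.drop b)).filter (· ≠ []) := by
  induction rows generalizing q with
  | nil =>
    obtain ⟨hne, hq, -, -⟩ := isTableau_cons.1 h
    have htake : q.take b ≠ [] := by simp [hne, hb.ne']
    rw [insertWord_nil_rows htake, rowInsertWord_nil_left (hq.sublist (List.take_sublist _ _))]
    simp
  | cons s rows ih =>
    obtain ⟨-, hq, hcol, hrows⟩ := isTableau_cons.1 h
    have hqs : ColLT q s := hcol s (by simp)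
    have hlen : s.drop b ≠ [] → (q.take b).length = b := fun hs => by
      have := hqs.length_le
      rw [Ne, List.drop_eq_nil_iff] at hs
      rw [List.length_take]
      omega
    obtain ⟨htake, hdrop⟩ := insertWord_cons_of_colLT_take rows
      (hq.sublist (List.take_sublist _ _)) (by simp) hlen (hqs.take b)
    obtain ⟨ih_take, ih_drop⟩ := ih hrows
    refine ⟨by rw [htake, ih_take, List.map_cons, List.map_cons, List.map_cons], ?_⟩
    rw [hdrop, List.map_cons, List.filter_cons, List.filter_cons, ih_drop]

theorem insertWord_row_cut {b : ℕ} (hb : 0 < b) {rows : List (List ℤ)}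
    (h : IsTableau rows) {x : List ℤ} (hx : x.Pairwise (· ≤ ·)) (hxb : x.length = b)
    (hcol : ColLT x ((firstRow rows).take b)) :
    (insertWord rows x).map (List.take b) = x :: rows.map (List.take b) ∧
      ((insertWord rows x).map (List.drop b)).filter (· ≠ []) =
        (rows.map (List.drop b)).filter (· ≠ []) := by
  cases rows with
  | nil =>
    rw [insertWord_nil_rows (List.length_pos_iff.1 (hxb ▸ hb)), rowInsertWord_nil_left hx]
    simp [← hxb]
  | cons q rows =>
    obtain ⟨htake, hdrop⟩ := insertWord_cons_of_colLT_take rows hx hxb.le (fun _ => hxb)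
      (s := q) hcol
    obtain ⟨htake', hdrop'⟩ := insertWord_take_cut hb h
    refine ⟨by rw [htake, htake'], ?_⟩
    rw [hdrop, List.map_cons, List.filter_cons, List.filter_cons, hdrop']

theorem length_glueRows : ∀ {T P : List (List ℤ)}, P.length ≤ T.length →
    (glueRows T P).length = T.length
  | [], P, h => by simpa using h
  | _ :: _, [], _ => by simp
  | t :: T, p :: P, h => by
    simp [glueRows, length_glueRows (T := T) (P := P) (by simpa using h)]

theorem glueRows_eq_append_drop : ∀ {T P : List (List ℤ)},
    glueRows T P = glueRows T (P.take T.length) ++ P.drop T.length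
  | [], P => by simp
  | _ :: _, [] => by simp
  | t :: T, p :: P => by simp [glueRows, glueRows_eq_append_drop (T := T) (P := P)]

theorem exists_append_of_mem_glueRows : ∀ {T P : List (List ℤ)}, P.length ≤ T.length →
    ∀ {q : List ℤ}, q ∈ glueRows T P →
      ∃ t ∈ T, ∃ p, q = t ++ p ∧ (p ∈ P ∨ p = [] ∧ P.length < T.length)
  | [], P, h, q, hq => by
    obtain rfl : P = [] := by simpa using h
    simp at hq
  | t :: T, [], _, q, hq => ⟨q, by simpa using hq, [], by simp⟩
  | t :: T, p :: P, h, q, hq => by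
    rcases List.mem_cons.1 hq with rfl | hq
    · exact ⟨t, by simp, p, rfl, by simp⟩
    · obtain ⟨t', ht', p', rfl, hp'⟩ :=
        exists_append_of_mem_glueRows (T := T) (P := P) (by simpa using h) hq
      refine ⟨t', by simp [ht'], p', rfl, ?_⟩
      simpa using hp'.imp .inr id

theorem beside_of_forall_le {b : ℕ} : ∀ {L R : List (List ℤ)}, R.length ≤ L.length →
    (∀ l ∈ L, l.length = b) → (∀ l ∈ L, ∀ r ∈ R, ∀ x ∈ l, ∀ y ∈ r, x ≤ y) → Beside b L R
  | _, [], _, h, _ => beside_nil_right.2 fun l hl => (h l hl).le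
  | [], _ :: _, h, _, _ => by simp at h
  | l :: L, r :: R, h, h', h'' => ⟨h' l (by simp), h'' l (by simp) r (by simp),
      beside_of_forall_le (by simpa using h) (fun k hk => h' k (by simp [hk]))
        fun k hk s hs => h'' k (by simp [hk]) s (by simp [hs])⟩

theorem rowLE_of_forall_le : ∀ {L R : List (List ℤ)},
    (∀ l ∈ L, ∀ r ∈ R, ∀ x ∈ l, ∀ y ∈ r, x ≤ y) → RowLE L R
  | _, [], _ => by simp
  | [], _ :: _, _ => by simp
  | l :: L, r :: R, h => ⟨h l (by simp) r (by simp),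
      rowLE_of_forall_le fun k hk s hs => h k (by simp [hk]) s (by simp [hs])⟩

namespace Tableau

theorem length_firstRow_le {b : ℕ} {Q : Tableau} (h : Q.right b = ∅) :
    (firstRow Q.rows).length ≤ b := by
  rw [← List.drop_eq_nil_iff]
  by_contra hne
  cases hQ : Q.rows with
  | nil => simp [hQ, firstRow] at hne
  | cons q qs =>
    have hmem : q.drop b ∈ (Q.right b).rows := by
      rw [right_rows, hQ]
      exact List.mem_filter.2 ⟨by simp, by simpa [hQ, firstRow] using hne⟩
    simp [h] at hmem

theorem firstRow_left {b : ℕ} (hb : 0 < b) (T : Tableau) :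
    firstRow (T.left b).rows = (firstRow T.rows).take b := by
  rw [left_rows_of_pos hb]
  cases T.rows <;> simp [firstRow]

theorem mul_cut_of_forall_lt {b : ℕ} (hb : 0 < b) (Q : Tableau) {rows : List (List ℤ)}
    (hT : IsTableau rows) (hlen : ∀ r ∈ rows, r.length = b)
    (h : ∀ r ∈ rows, ∀ x ∈ r, ∀ y ∈ Q.word, x < y) :
    ((Q * ⟨rows, hT⟩).left b).rows = rows ++ (Q.left b).rows ∧
      (Q * ⟨rows, hT⟩).right b = Q.right b := by
  induction rows with
  | nil => exact ⟨rfl, rfl⟩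
  | cons t rows ih =>
    obtain ⟨-, ht, hcol, hrows⟩ := isTableau_cons.1 hT
    rw [List.forall_mem_cons] at hlen h
    obtain ⟨hleft, hright⟩ := ih hrows hlen.2 h.2
    set S := Q * ⟨rows, hrows⟩
    have hmul : (Q * ⟨t :: rows, hT⟩).rows = insertWord S.rows t := by
      rw [mul_rows, rowWord_cons, insertWord_append]
      rfl
    have hcol' : ColLT t ((firstRow S.rows).take b) := by
      rw [← firstRow_left hb, hleft]
      cases rows with
      | nil =>
        have hle : (firstRow (Q.left b).rows).length ≤ t.length := by
          simp [firstRow_left hb, hlen.1]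
        exact colLT_of_forall_lt hle fun x hx y hy =>
          h.1 x hx y (mem_of_mem_word_left (mem_of_mem_firstRow hy))
      | cons s rows => exact hcol s (by simp)
    obtain ⟨htake, hdrop⟩ := insertWord_row_cut hb S.isTableau ht hlen.1 hcol'
    refine ⟨?_, Tableau.ext ?_⟩
    · rw [left_rows_of_pos hb, hmul, htake, ← left_rows_of_pos hb, hleft, List.cons_append]
    · rw [right_rows, hmul, hdrop, ← right_rows, hright]

namespace IsRect

variable {a b : ℕ} {T : Tableau}

theorem length_of_mem (h : T.IsRect a b) : ∀ r ∈ T.rows, r.length = b := by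
  intro r hr
  obtain ⟨i, hi, rfl⟩ := List.getElem_of_mem hr
  have lt_length_iff : ∀ j, j < T.rows[i].length ↔ i < a ∧ j < b := fun j => by
    simpa [entry, hi] using h i j
  have ha := ((lt_length_iff 0).1 (List.length_pos_of_ne_nil (T.isTableau.ne_nil _ hr))).1
  have := lt_length_iff T.rows[i].length
  have := lt_length_iff b
  omega

theorem length_rows (h : T.IsRect a b) (hb : 0 < b) : T.rows.length = a := by
  have lt_length_iff : ∀ i, i < T.rows.length ↔ i < a := fun i => by
    rw [← and_iff_left (a := i < a) hb, ← h i 0]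
    refine ⟨fun hi => ?_, fun hs => ?_⟩
    · have hpos := List.length_pos_of_ne_nil (T.isTableau.ne_nil _ (List.getElem_mem hi))
      simp [entry, hi, hpos]
    · by_contra hi
      simp [entry, List.getElem?_eq_none (not_lt.1 hi)] at hs
  have := lt_length_iff T.rows.length
  have := lt_length_iff a
  omega

theorem eq_empty (h : T.IsRect a 0) : T = ∅ := by
  ext1
  rw [empty_rows, List.eq_nil_iff_forall_not_mem]
  exact fun r hr => T.isTableau.ne_nil r hr (List.length_eq_zero_iff.1 (h.length_of_mem r hr))

theorem mul_eq_left_mul_mul_right {Q : Tableau} (hT : T.IsRect a b)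
    (h : ∀ x ∈ T.word, ∀ y ∈ Q.word, x < y) : Q * T = Q.left b * T * Q.right b := by
  rcases Nat.eq_zero_or_pos b with rfl | hb
  · simp [hT.eq_empty]
  obtain ⟨hleft, hright⟩ := mul_cut_of_forall_lt hb Q T.isTableau hT.length_of_mem
    fun r hr x hx => h x (mem_rowWord.2 ⟨r, hr, hx⟩)
  have hstack : (Q.left b * T).rows = T.rows ++ (Q.left b).rows :=
    mul_rows_of_isTableau_append (hleft ▸ Tableau.isTableau _)
  rw [show Q.left b * T = (Q * T).left b from Tableau.ext (hstack.trans hleft.symm), ← hright]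
  exact (left_mul_right b _).symm

theorem beside_top {P : Tableau} (hT : T.IsRect a b) (hb : 0 < b)
    (hP : ∀ x ∈ T.word, ∀ y ∈ P.word, x < y) : Beside b T.rows (P.top a).rows :=
  beside_of_forall_le (by simp [top_rows, hT.length_rows hb]) hT.length_of_mem
    fun l hl r hr x hx y hy => (hP x (mem_rowWord.2 ⟨l, hl, hx⟩) y
      (mem_rowWord.2 ⟨r, List.mem_of_mem_take hr, hy⟩)).le

theorem length_mul_top_rows {P : Tableau} (hT : T.IsRect a b) (hb : 0 < b)
    (hP : ∀ x ∈ T.word, ∀ y ∈ P.word, x < y) : (T * P.top a).rows.length = a := by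
  rw [mul_rows_of_beside (hT.beside_top hb hP),
    length_glueRows (by simp [top_rows, hT.length_rows hb]), hT.length_rows hb]

theorem mul_eq_below_mul {P : Tableau} (hT : T.IsRect a b) (hb : 0 < b)
    (hP : ∀ x ∈ T.word, ∀ y ∈ P.word, x < y) : T * P = P.below a * (T * P.top a) := by
  have hrow : RowLE T.rows P.rows := rowLE_of_forall_le fun l hl r hr x hx y hy =>
    (hP x (mem_rowWord.2 ⟨l, hl, hx⟩) y (mem_rowWord.2 ⟨r, hr, hy⟩)).le
  have hstack : (T * P).rows = (T * P.top a).rows ++ (P.below a).rows := by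
    rw [mul_rows_of_beside (hT.beside_top hb hP), mul_rows,
      insertWord_rowWord P.isTableau hrow, glueRows_eq_append_drop, hT.length_rows hb, top_rows,
      below_rows]
  have hisTableau : IsTableau ((T * P.top a).rows ++ (P.below a).rows) :=
    hstack ▸ (T * P).isTableau
  exact Tableau.ext (hstack.trans (mul_rows_of_isTableau_append hisTableau).symm)

variable {Q P : Tableau}

/-- `Q` shifts the entries of `P.below a` in the first row by at most `b` places, which the
rectangle on top makes up for. -/
theorem isTableau_mul_top_append (hT : T.IsRect a b) (hb : 0 < b)
    (hQ : ∀ x ∈ T.word, ∀ y ∈ Q.word, x < y) (hP : ∀ x ∈ T.word, ∀ y ∈ P.word, x < y)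
    (hQb : Q.right b = ∅) : IsTableau ((T * P.top a).rows ++ (Q * P.below a).rows) := by
  refine (Tableau.isTableau _).append (Tableau.isTableau _) fun p hp => ?_
  refine colLT_of_countP ((Tableau.isTableau _).row_weak p hp)
    (Tableau.isTableau _).firstRow_sorted fun m hm => ?_
  rw [mul_rows_of_beside (hT.beside_top hb hP)] at hp
  obtain ⟨t, ht, q, rfl, hq⟩ := exists_append_of_mem_glueRows
    (by simp [top_rows, hT.length_rows hb]) hp
  have htm : t.countP (· < m) = b := by
    rw [← hT.length_of_mem t ht, List.countP_eq_length]
    intro x hx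
    have hxT : x ∈ T.word := mem_rowWord.2 ⟨t, ht, hx⟩
    simpa using (mem_word_mul.1 (mem_of_mem_firstRow hm)).elim (hQ x hxT m)
      fun hmP => hP x hxT m (mem_of_mem_word_below hmP)
  have hqm : (firstRow (P.below a).rows).countP (· ≤ m) ≤ q.countP (· < m) := by
    rcases hq with hq | ⟨rfl, hq⟩
    · exact (colLT_firstRow_below hq).countP_le m
    · have hnil : (P.below a).rows = [] := by
        rw [top_rows, List.length_take, hT.length_rows hb] at hq
        rw [below_rows, List.drop_eq_nil_iff]
        omega
      simp [hnil, firstRow]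
  calc (firstRow (Q * P.below a).rows).countP (· ≤ m)
      ≤ (firstRow (P.below a).rows).countP (· ≤ m) + (firstRow Q.rows).countP (· ≤ m) :=
        (countP_firstRow_mul Q _ m).2
    _ ≤ q.countP (· < m) + b :=
        add_le_add hqm (List.countP_le_length.trans (length_firstRow_le hQb))
    _ = (t ++ q).countP (· < m) := by rw [List.countP_append, htm, add_comm]

theorem mul_mul_rows (hT : T.IsRect a b) (hb : 0 < b)
    (hQ : ∀ x ∈ T.word, ∀ y ∈ Q.word, x < y) (hP : ∀ x ∈ T.word, ∀ y ∈ P.word, x < y)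
    (hQb : Q.right b = ∅) :
    (Q * T * P).rows = (T * P.top a).rows ++ (Q * P.below a).rows := by
  rw [mul_assoc, hT.mul_eq_below_mul hb hP, ← mul_assoc,
    mul_rows_of_isTableau_append (hT.isTableau_mul_top_append hb hQ hP hQb)]

theorem below_mul_mul (hT : T.IsRect a b)
    (hQ : ∀ x ∈ T.word, ∀ y ∈ Q.word, x < y) (hP : ∀ x ∈ T.word, ∀ y ∈ P.word, x < y)
    (hQb : Q.right b = ∅) : (Q * T * P).below a = Q * P.below a := by
  rcases Nat.eq_zero_or_pos b with rfl | hb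
  · rw [right_zero] at hQb
    simp [hQb, hT.eq_empty]
  · ext1
    rw [below_rows, hT.mul_mul_rows hb hQ hP hQb, List.drop_left' (hT.length_mul_top_rows hb hP)]

theorem top_mul_mul (hT : T.IsRect a b)
    (hQ : ∀ x ∈ T.word, ∀ y ∈ Q.word, x < y) (hP : ∀ x ∈ T.word, ∀ y ∈ P.word, x < y)
    (hQb : Q.right b = ∅) : (Q * T * P).top a = T * P.top a := by
  rcases Nat.eq_zero_or_pos b with rfl | hb
  · rw [right_zero] at hQb
    simp [hQb, hT.eq_empty]
  · ext1
    rw [top_rows, hT.mul_mul_rows hb hQ hP hQb, List.take_left' (hT.length_mul_top_rows hb hP)]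

theorem left_mul_top (hT : T.IsRect a b) (hP : ∀ x ∈ T.word, ∀ y ∈ P.word, x < y) :
    (T * P.top a).left b = T := by
  rcases Nat.eq_zero_or_pos b with rfl | hb
  · simp [hT.eq_empty]
  · exact left_mul_of_beside (hT.beside_top hb hP)

theorem right_mul_top (hT : T.IsRect a b) (hP : ∀ x ∈ T.word, ∀ y ∈ P.word, x < y) :
    (T * P.top a).right b = P.top a := by
  rcases Nat.eq_zero_or_pos b with rfl | hb
  · simp [hT.eq_empty]
  · exact right_mul_of_beside (hT.beside_top hb hP)

end IsRect

/-! ### Simple factorizations and splitting off factors -/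

theorem isSimpleFactorization_right {a b : ℕ} {W T : Tableau} (h : (W.top a).left b = T) :
    IsSimpleFactorization a b W ((W.below a).left b) T (W.right b) := by
  refine ⟨h.symm, ?_, ∅, (W.below a).right b, by simp, by simp, ?_⟩
  · rw [← h, left_below, left_top, below_mul_top, left_mul_right]
  · rw [right_below, right_top, below_mul_top]

theorem isSimpleFactorization_below {a b : ℕ} {W T : Tableau} (h : (W.top a).left b = T) :
    IsSimpleFactorization a b W (W.below a) T ((W.top a).right b) := by
  refine ⟨h.symm, ?_, (W.below a).right b, ∅, by simp, by simp, by simp⟩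
  rw [← h, mul_assoc, left_mul_right, below_mul_top]

section SplitRight

variable {b c : ℕ} {Q C E : Tableau}

theorem left_mul_left_mul (h : Q.right b = C * E) (A : Tableau) :
    (A * (Q.left b * C)).left b = (A * Q).left b := by
  rw [left_mul, left_left_mul_of_right_eq_mul h, ← left_mul]

theorem left_mul_left_mul_of_le (hcb : c ≤ b) (h : Q.right b = C * E) (A : Tableau) :
    (A * (Q.left b * C)).left c = (A * Q).left c := by
  rw [← left_left hcb, left_mul_left_mul h, left_left hcb]

theorem right_mul_eq_mul (hcb : c ≤ b) (h : Q.right b = C * E) (A : Tableau) :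
    (A * Q).right c = (A * (Q.left b * C)).right c * E := by
  have hb : (A * Q).right b = (A * (Q.left b * C)).right b * E := by
    rw [right_mul, right_mul b A (Q.left b * C), left_left_mul_of_right_eq_mul h,
      right_left_mul_of_right_eq_mul h, h, mul_assoc]
  rw [right_eq_mul hcb, hb, ← left_mul_left_mul h, ← mul_assoc, ← right_eq_mul hcb]

end SplitRight

section SplitBelow

variable {a c : ℕ} {P C E : Tableau}

theorem top_mul_top_mul (h : P.below a = C * E) (B : Tableau) :
    (E * P.top a * B).top a = (P * B).top a := by
  rw [top_mul, top_mul_top_of_below_eq_mul h, ← top_mul]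

theorem top_mul_top_mul_of_le (hca : c ≤ a) (h : P.below a = C * E) (B : Tableau) :
    (E * P.top a * B).top c = (P * B).top c := by
  rw [← top_top hca, top_mul_top_mul h, top_top hca]

theorem below_mul_eq_mul (hca : c ≤ a) (h : P.below a = C * E) (B : Tableau) :
    (P * B).below c = C * (E * P.top a * B).below c := by
  have ha : (P * B).below a = C * (E * P.top a * B).below a := by
    rw [below_mul, below_mul a (E * P.top a), top_mul_top_of_below_eq_mul h,
      below_mul_top_of_below_eq_mul h, h, mul_assoc]
  rw [below_eq_mul hca, ha, ← top_mul_top_mul h, mul_assoc, ← below_eq_mul hca]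

end SplitBelow

end Tableau

/-! ### Factor sequences -/

theorem RankConditions.numCols_bottom_le {n : ℕ} (r : RankConditions (n + 1)) {i : ℕ} (hi : i < n) :
    r.bottom.numCols i (i + 1) ≤ r.numCols (i + 1) (i + 1 + 1) := by
  have := r.occur i (i + 1 + 1) le_rfl (by omega)
  simp only [RankConditions.numCols, RankConditions.bottom, Nat.add_sub_cancel] at this ⊢
  omega

theorem RankConditions.numRows_bottom_le {n : ℕ} (r : RankConditions (n + 1)) {i : ℕ} (hi : i < n) :
    r.bottom.numRows i (i + 1) ≤ r.numRows i (i + 1) := by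
  have := r.occur i (i + 1 + 1) le_rfl (by omega)
  simp only [RankConditions.numRows, RankConditions.bottom, Nat.add_sub_cancel] at this ⊢
  omega

theorem TableauDiagram.isRect_first {m : ℕ} {r : RankConditions (m + 1)} (D : TableauDiagram r)
    (i : Fin (m + 1)) : (D.T i (i + 1)).IsRect (r.numRows i (i + 1)) (r.numCols i (i + 1)) :=
  D.isRect i (i + 1) (by omega) (by omega)

/-- The first tableau of `Q` and the last tableau of `P` are empty, and the products of the
other tableaux form a factor sequence for the bottom rows of the diagram. Tableaux
`W i = Q i * D.T i (i + 1) * P i` obtained from such a pair are the general factor sequence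
for `D`. -/
def IsFactorPair {m : ℕ} {r : RankConditions (m + 1)} (D : TableauDiagram r)
    (Q P : Fin (m + 1) → Tableau) : Prop :=
  Q 0 = ∅ ∧ P (Fin.last m) = ∅ ∧
    IsFactorSequence D.bottom (fun i : Fin m => P i.castSucc * Q i.succ)

theorem isFactorSequence_iff_of_fin_one {r : RankConditions 1} (D : TableauDiagram r)
    (W : Fin 1 → Tableau) :
    IsFactorSequence D W ↔ ∃ Q P : Fin 1 → Tableau,
      (∀ i, W i = Q i * D.T i (i + 1) * P i) ∧ IsFactorPair D Q P := by
  constructor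
  · intro h
    refine ⟨fun _ => ∅, fun _ => ∅, fun i => ?_, rfl, rfl, trivial⟩
    obtain rfl : i = 0 := Fin.fin_one_eq_zero i
    simpa using (show W 0 = D.T 0 1 from h)
  · rintro ⟨Q, P, hW, hQ, hP, -⟩
    have h := hW 0
    rw [hQ, show P 0 = ∅ from hP] at h
    exact h.trans (by simp)

theorem isFactorSequence_iff {m : ℕ} {r : RankConditions (m + 1)} (D : TableauDiagram r)
    (W : Fin (m + 1) → Tableau) :
    IsFactorSequence D W ↔ ∃ Q P : Fin (m + 1) → Tableau,
      (∀ i, W i = Q i * D.T i (i + 1) * P i) ∧ IsFactorPair D Q P := by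
  rcases m with _ | m
  · exact isFactorSequence_iff_of_fin_one D W
  constructor
  · rintro ⟨U, P, Q, hU, hPQ, hfirst, hmid, hlast⟩
    refine ⟨Fin.cons ∅ Q, Fin.snoc P ∅, fun i => ?_, by simp, by simp, ?_⟩
    · cases i using Fin.cases with
      | zero =>
        have hsnoc : (Fin.snoc P ∅ : Fin (m + 2) → Tableau) 0 = P 0 :=
          Fin.snoc_castSucc (α := fun _ => Tableau) ∅ P 0
        rw [hfirst, hsnoc, Fin.cons_zero]
        simp
      | succ k =>
        cases k using Fin.lastCases with
        | last =>
          rw [Fin.succ_last, hlast, Fin.snoc_last, ← Fin.succ_last, Fin.cons_succ]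
          simp
        | cast j =>
          rw [Fin.cons_succ, Fin.succ_castSucc, hmid, Fin.snoc_castSucc]
          simp
    · simpa only [Fin.snoc_castSucc, Fin.cons_succ, ← hPQ] using hU
  · rintro ⟨Q, P, hW, hQ, hP, hU⟩
    refine ⟨_, fun i => P i.castSucc, fun i => Q i.succ, hU, fun i => rfl, ?_, fun i => ?_, ?_⟩
    · simpa [hQ] using hW 0
    · simpa using hW i.succ.castSucc
    · simpa [hP] using hW (Fin.last (m + 1))

theorem IsFactorSequence.exists_mem_word {n : ℕ} {r : RankConditions n} {D : TableauDiagram r}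
    {W : Fin n → Tableau} (h : IsFactorSequence D W) (i : Fin n) {x : ℤ} (hx : x ∈ (W i).word) :
    ∃ k l, k ≤ (i : ℕ) ∧ (i : ℕ) < l ∧ l ≤ n ∧ x ∈ (D.T k l).word := by
  induction n with
  | zero => exact i.elim0
  | succ m ih =>
    obtain ⟨Q, P, hW, hQ, hP, hU⟩ := (isFactorSequence_iff D W).1 h
    rw [hW, Tableau.mem_word_mul, Tableau.mem_word_mul] at hx
    rcases hx with (hx | hx) | hx
    · cases i using Fin.cases with
      | zero => simp [hQ, Tableau.word] at hx
      | succ j =>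
        obtain ⟨k, l, hkj, hjl, hl, hxkl⟩ := ih hU j (Tableau.mem_word_mul.2 (.inr hx))
        exact ⟨k, l + 1, by rw [Fin.val_succ]; omega, by rw [Fin.val_succ]; omega, by omega, hxkl⟩
    · exact ⟨i, i + 1, le_rfl, by omega, by omega, hx⟩
    · cases i using Fin.lastCases with
      | last => simp [hP, Tableau.word] at hx
      | cast j =>
        obtain ⟨k, l, hkj, hjl, hl, hxkl⟩ := ih hU j (Tableau.mem_word_mul.2 (.inl hx))
        exact ⟨k, l + 1, hkj, by rw [Fin.val_castSucc]; omega, by omega, hxkl⟩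

theorem IsFactorSequence.lt_of_mem_word {m : ℕ} {r : RankConditions (m + 1)}
    {D : TableauDiagram r} {U : Fin m → Tableau} (h : IsFactorSequence D.bottom U) (j : Fin m)
    {i : ℕ} (hi : i = j ∨ i = j + 1) :
    ∀ x ∈ (D.T i (i + 1)).word, ∀ y ∈ (U j).word, x < y := by
  intro x hx y hy
  obtain ⟨k, l, hkj, hjl, hl, hykl⟩ := h.exists_mem_word j hy
  exact D.lt k (l + 1) i (i + 1) (by omega) (by omega) (by omega) (by omega)
    (by simp only [ne_eq, Prod.mk.injEq]; omega) x hx y hykl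

/-- Simple factorizations descend from `D` to its bottom rows: any simple factorizations of the
tableaux of a factor sequence for `D` form a factor pair. -/
def SimpleFactorizationsDescend {m : ℕ} {r : RankConditions (m + 1)} (D : TableauDiagram r) :
    Prop :=
  ∀ W Q P : Fin (m + 1) → Tableau,
    (∀ i : Fin (m + 1), Tableau.IsSimpleFactorization
      (r.numRows i (i + 1)) (r.numCols i (i + 1)) (W i) (Q i) (D.T i (i + 1)) (P i)) →
    IsFactorSequence D W → IsFactorPair D Q P

namespace IsFactorPair

section Basic

variable {m : ℕ} {r : RankConditions (m + 1)} {D : TableauDiagram r} {Q P : Fin (m + 1) → Tableau}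

theorem lt_left (h : IsFactorPair D Q P) (i : Fin (m + 1)) :
    ∀ x ∈ (D.T i (i + 1)).word, ∀ y ∈ (Q i).word, x < y := by
  intro x hx y hy
  cases i using Fin.cases with
  | zero => simp [h.1, Tableau.word] at hy
  | succ j => exact h.2.2.lt_of_mem_word j (.inr rfl) x hx y (Tableau.mem_word_mul.2 (.inr hy))

theorem lt_right (h : IsFactorPair D Q P) (i : Fin (m + 1)) :
    ∀ x ∈ (D.T i (i + 1)).word, ∀ y ∈ (P i).word, x < y := by
  intro x hx y hy
  cases i using Fin.lastCases with
  | last => simp [h.2.1, Tableau.word] at hy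
  | cast j => exact h.2.2.lt_of_mem_word j (.inl rfl) x hx y (Tableau.mem_word_mul.2 (.inl hy))

theorem lt_right_mul (h : IsFactorPair D Q P) (i : Fin (m + 1)) (b : ℕ) :
    ∀ x ∈ (D.T i (i + 1)).word, ∀ y ∈ ((Q i).right b * P i).word, x < y := fun x hx y hy =>
  (Tableau.mem_word_mul.1 hy).elim
    (fun hQ => h.lt_left i x hx y (Tableau.mem_of_mem_word_right hQ)) (h.lt_right i x hx y)

theorem mul_mul_eq (h : IsFactorPair D Q P) (i : Fin (m + 1)) :
    Q i * D.T i (i + 1) * P i = (Q i).left (r.numCols i (i + 1)) * D.T i (i + 1) *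
      ((Q i).right (r.numCols i (i + 1)) * P i) := by
  rw [(D.isRect_first i).mul_eq_left_mul_mul_right (h.lt_left i), mul_assoc]

theorem below_mul_mul (h : IsFactorPair D Q P) (i : Fin (m + 1)) :
    (Q i * D.T i (i + 1) * P i).below (r.numRows i (i + 1)) =
      (Q i).left (r.numCols i (i + 1)) *
        ((Q i).right (r.numCols i (i + 1)) * P i).below (r.numRows i (i + 1)) := by
  rw [h.mul_mul_eq i]
  exact (D.isRect_first i).below_mul_mul
    (fun x hx y hy => h.lt_left i x hx y (Tableau.mem_of_mem_word_left hy)) (h.lt_right_mul i _)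
    (by simp)

theorem top_mul_mul (h : IsFactorPair D Q P) (i : Fin (m + 1)) :
    (Q i * D.T i (i + 1) * P i).top (r.numRows i (i + 1)) =
      D.T i (i + 1) *
        ((Q i).right (r.numCols i (i + 1)) * P i).top (r.numRows i (i + 1)) := by
  rw [h.mul_mul_eq i]
  exact (D.isRect_first i).top_mul_mul
    (fun x hx y hy => h.lt_left i x hx y (Tableau.mem_of_mem_word_left hy)) (h.lt_right_mul i _)
    (by simp)

theorem top_left_mul_mul (h : IsFactorPair D Q P) (i : Fin (m + 1)) :
    ((Q i * D.T i (i + 1) * P i).top (r.numRows i (i + 1))).left (r.numCols i (i + 1)) =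
      D.T i (i + 1) := by
  rw [h.top_mul_mul i, (D.isRect_first i).left_mul_top (h.lt_right_mul i _)]

theorem top_right_mul_mul (h : IsFactorPair D Q P) (i : Fin (m + 1)) :
    ((Q i * D.T i (i + 1) * P i).top (r.numRows i (i + 1))).right (r.numCols i (i + 1)) =
      ((Q i).right (r.numCols i (i + 1)) * P i).top (r.numRows i (i + 1)) := by
  rw [h.top_mul_mul i, (D.isRect_first i).right_mul_top (h.lt_right_mul i _)]

theorem update_succ_castSucc (h : IsFactorPair D Q P) (j : Fin m) {q p : Tableau}
    (hpq : p * q = P j.castSucc * Q j.succ) :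
    IsFactorPair D (Function.update Q j.succ q) (Function.update P j.castSucc p) := by
  refine ⟨?_, ?_, ?_⟩
  · rw [Function.update_of_ne (Fin.succ_ne_zero j).symm, h.1]
  · rw [Function.update_of_ne (Fin.castSucc_lt_last j).ne', h.2.1]
  · convert h.2.2 using 2 with k
    rcases eq_or_ne k j with rfl | hkj
    · rw [Function.update_self, Function.update_self, hpq]
    · rw [Function.update_of_ne ((Fin.castSucc_injective m).ne hkj),
        Function.update_of_ne ((Fin.succ_injective m).ne hkj)]

theorem isFactorSequence_update (h : IsFactorPair D Q P) {U : Fin (m + 1) → Tableau}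
    (hU : ∀ i, U i = Q i * D.T i (i + 1) * P i) (j : Fin m) {q p : Tableau}
    (hpq : p * q = P j.castSucc * Q j.succ) :
    IsFactorSequence D (Function.update
      (Function.update U j.castSucc (Q j.castSucc * D.T j.castSucc (j.castSucc + 1) * p))
      j.succ (q * D.T j.succ (j.succ + 1) * P j.succ)) := by
  refine (isFactorSequence_iff D _).2 ⟨_, _, fun i => ?_, h.update_succ_castSucc j hpq⟩
  have hne : j.succ ≠ j.castSucc := Fin.castSucc_lt_succ.ne'
  rcases eq_or_ne i j.succ with rfl | hi
  · rw [Function.update_self, Function.update_self, Function.update_of_ne hne]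
  · rw [Function.update_of_ne hi, Function.update_of_ne hi]
    rcases eq_or_ne i j.castSucc with rfl | hi'
    · rw [Function.update_self, Function.update_self]
    · rw [Function.update_of_ne hi', Function.update_of_ne hi', hU]

end Basic

end IsFactorPair

namespace IsFactorSequence

variable {m : ℕ} {r : RankConditions (m + 1)} {D : TableauDiagram r} {U : Fin (m + 1) → Tableau}

theorem top_left (hU : IsFactorSequence D U) (i : Fin (m + 1)) :
    ((U i).top (r.numRows i (i + 1))).left (r.numCols i (i + 1)) = D.T i (i + 1) := by
  obtain ⟨Q, P, hQP, h⟩ := (isFactorSequence_iff D U).1 hU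
  rw [hQP, h.top_left_mul_mul]

theorem isFactorPair_right (H : SimpleFactorizationsDescend D) (hU : IsFactorSequence D U) :
    IsFactorPair D
      (fun i => ((U i).below (r.numRows i (i + 1))).left (r.numCols i (i + 1)))
      (fun i => (U i).right (r.numCols i (i + 1))) :=
  H U _ _ (fun i => Tableau.isSimpleFactorization_right (hU.top_left i)) hU

theorem isFactorPair_below (H : SimpleFactorizationsDescend D) (hU : IsFactorSequence D U) :
    IsFactorPair D
      (fun i => (U i).below (r.numRows i (i + 1)))
      (fun i => ((U i).top (r.numRows i (i + 1))).right (r.numCols i (i + 1))) :=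
  H U _ _ (fun i => Tableau.isSimpleFactorization_below (hU.top_left i)) hU

theorem move_right (H : SimpleFactorizationsDescend D) (hU : IsFactorSequence D U) (j : Fin m)
    {V E : Tableau}
    (hleft : V.left (r.numCols j (j + 1)) = (U j.castSucc).left (r.numCols j (j + 1)))
    (hright : (U j.castSucc).right (r.numCols j (j + 1)) = V.right (r.numCols j (j + 1)) * E) :
    IsFactorSequence D (Function.update (Function.update U j.castSucc V) j.succ
      (E * U j.succ)) := by
  have hU_eq := fun i => (Tableau.isSimpleFactorization_right (hU.top_left i)).2.1
  have hV : V = ((U j.castSucc).below (r.numRows j (j + 1))).left (r.numCols j (j + 1)) *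
      D.T j (j + 1) * V.right (r.numCols j (j + 1)) := by
    have hT := hU.top_left j.castSucc
    rw [Fin.val_castSucc] at hT
    rw [← hT, Tableau.left_below, Tableau.left_top, Tableau.below_mul_top, ← hleft,
      Tableau.left_mul_right]
  have h := (hU.isFactorPair_right H).isFactorSequence_update hU_eq j
    (p := V.right (r.numCols j (j + 1)))
    (q := E * ((U j.succ).below (r.numRows j.succ (j.succ + 1))).left
      (r.numCols j.succ (j.succ + 1))) (by rw [← mul_assoc, ← hright]; rfl)
  rwa [mul_assoc E, mul_assoc E, ← hU_eq, Fin.val_castSucc, ← hV] at h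

theorem move_left (H : SimpleFactorizationsDescend D) (hU : IsFactorSequence D U) (j : Fin m)
    {V C : Tableau}
    (htop : V.top (r.numRows j.succ (j.succ + 1)) = (U j.succ).top (r.numRows j.succ (j.succ + 1)))
    (hbelow : (U j.succ).below (r.numRows j.succ (j.succ + 1)) =
      C * V.below (r.numRows j.succ (j.succ + 1))) :
    IsFactorSequence D (Function.update (Function.update U j.castSucc (U j.castSucc * C))
      j.succ V) := by
  have hU_eq := fun i => (Tableau.isSimpleFactorization_below (hU.top_left i)).2.1
  have hV : V = V.below (r.numRows j.succ (j.succ + 1)) * D.T j.succ (j.succ + 1) *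
      ((U j.succ).top (r.numRows j.succ (j.succ + 1))).right (r.numCols j.succ (j.succ + 1)) := by
    rw [← hU.top_left j.succ, mul_assoc, Tableau.left_mul_right, ← htop, Tableau.below_mul_top]
  have h := (hU.isFactorPair_below H).isFactorSequence_update hU_eq j
    (p := ((U j.castSucc).top (r.numRows j.castSucc (j.castSucc + 1))).right
      (r.numCols j.castSucc (j.castSucc + 1)) * C)
    (q := V.below (r.numRows j.succ (j.succ + 1))) (by rw [mul_assoc, ← hbelow])
  rwa [← mul_assoc, ← hU_eq, ← hV] at h

end IsFactorSequence

namespace IsFactorPair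

variable {m : ℕ} {r : RankConditions (m + 1 + 1)} {D : TableauDiagram r}
  {Q P : Fin (m + 1 + 1) → Tableau}

theorem update_interior (h : IsFactorPair D Q P) (k : Fin m) {q p : Tableau}
    (hU : IsFactorSequence D.bottom (Function.update
      (Function.update (fun l : Fin (m + 1) => P l.castSucc * Q l.succ) k.castSucc
        (P k.castSucc.castSucc * q)) k.succ (p * Q k.succ.succ))) :
    IsFactorPair D (Function.update Q k.castSucc.succ q) (Function.update P k.castSucc.succ p) := by
  refine ⟨?_, ?_, ?_⟩
  · rw [Function.update_of_ne (Fin.succ_ne_zero _).symm, h.1]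
  · rw [Fin.succ_castSucc, Function.update_of_ne (Fin.castSucc_lt_last _).ne', h.2.1]
  · convert hU using 2 with l
    have hne : k.castSucc ≠ k.succ := Fin.castSucc_lt_succ.ne
    rcases eq_or_ne l k.succ with rfl | hl
    · rw [Function.update_self, Fin.succ_castSucc, Function.update_self, ← Fin.succ_castSucc,
        Function.update_of_ne ((Fin.succ_injective _).ne hne.symm)]
    · rw [Function.update_of_ne hl, Fin.succ_castSucc,
        Function.update_of_ne ((Fin.castSucc_injective _).ne hl), ← Fin.succ_castSucc]
      rcases eq_or_ne l k.castSucc with rfl | hl'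
      · rw [Function.update_self, Function.update_self]
      · rw [Function.update_of_ne hl', Function.update_of_ne ((Fin.succ_injective _).ne hl')]

theorem move_right (H : SimpleFactorizationsDescend D.bottom) (h : IsFactorPair D Q P)
    (i : Fin (m + 1 + 1)) {C E : Tableau} (hCE : (Q i).right (r.numCols i (i + 1)) = C * E) :
    IsFactorPair D (Function.update Q i ((Q i).left (r.numCols i (i + 1)) * C))
      (Function.update P i (E * P i)) := by
  have of_eq_empty (hE : E = ∅) :
      IsFactorPair D (Function.update Q i ((Q i).left (r.numCols i (i + 1)) * C))
        (Function.update P i (E * P i)) := by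
    rw [hE, Tableau.mul_empty] at hCE
    rwa [hE, ← hCE, Tableau.left_mul_right, Tableau.empty_mul, Function.update_eq_self,
      Function.update_eq_self]
  cases i using Fin.cases with
  | zero =>
    rw [h.1, Tableau.right_empty] at hCE
    exact of_eq_empty (Tableau.eq_empty_of_mul_eq_empty hCE.symm).2
  | succ j =>
    have hle := r.numCols_bottom_le j.isLt
    have hright := Tableau.right_mul_eq_mul hle hCE (P j.castSucc)
    cases j using Fin.lastCases with
    | last =>
      have hempty := (h.2.2.isFactorPair_right H).2.1
      exact of_eq_empty (Tableau.eq_empty_of_mul_eq_empty (hright.symm.trans hempty)).2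
    | cast k =>
      refine h.update_interior k ?_
      rw [mul_assoc E]
      exact h.2.2.move_right H k (Tableau.left_mul_left_mul_of_le hle hCE _) hright

theorem move_left (H : SimpleFactorizationsDescend D.bottom) (h : IsFactorPair D Q P)
    (i : Fin (m + 1 + 1)) {C E : Tableau} (hCE : (P i).below (r.numRows i (i + 1)) = C * E) :
    IsFactorPair D (Function.update Q i (Q i * C))
      (Function.update P i (E * (P i).top (r.numRows i (i + 1)))) := by
  have of_eq_empty (hC : C = ∅) : IsFactorPair D (Function.update Q i (Q i * C))
      (Function.update P i (E * (P i).top (r.numRows i (i + 1)))) := by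
    rw [hC, Tableau.empty_mul] at hCE
    rwa [hC, ← hCE, Tableau.below_mul_top, Tableau.mul_empty, Function.update_eq_self,
      Function.update_eq_self]
  cases i using Fin.lastCases with
  | last =>
    rw [h.2.1, Tableau.below_empty] at hCE
    exact of_eq_empty (Tableau.eq_empty_of_mul_eq_empty hCE.symm).1
  | cast j =>
    have hle := r.numRows_bottom_le j.isLt
    have hbelow := Tableau.below_mul_eq_mul hle hCE (Q j.succ)
    cases j using Fin.cases with
    | zero =>
      have hempty := (h.2.2.isFactorPair_below H).1
      exact of_eq_empty (Tableau.eq_empty_of_mul_eq_empty (hbelow.symm.trans hempty)).1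
    | succ k =>
      rw [← Fin.succ_castSucc]
      refine h.update_interior k ?_
      rw [← mul_assoc]
      exact h.2.2.move_left H k (Tableau.top_mul_top_mul_of_le hle hCE _) hbelow

/-- Moving everything of `Q i` right of the rectangle into `P i`, then everything of `P i` below
the rectangle back into `Q i`, gives the simple factorization in which the whole of `Z` belongs to
`q`; a last move to the right distributes `Z` as prescribed. -/
theorem update_of_isSimpleFactorization (H : SimpleFactorizationsDescend D.bottom)
    (h : IsFactorPair D Q P) (i : Fin (m + 1 + 1)) {q p : Tableau}
    (hs : Tableau.IsSimpleFactorization (r.numRows i (i + 1)) (r.numCols i (i + 1))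
      (Q i * D.T i (i + 1) * P i) q (D.T i (i + 1)) p) :
    IsFactorPair D (Function.update Q i q) (Function.update P i p) := by
  obtain ⟨-, -, Q', P', hZ, rfl, rfl⟩ := hs
  have h₁ := h.move_right H i (C := ∅) (by rw [Tableau.empty_mul])
  have h₂ := h₁.move_left H i (E := ∅) (by rw [Tableau.mul_empty])
  simp only [Function.update_self, Function.update_idem, Tableau.mul_empty, Tableau.empty_mul,
    ← h.below_mul_mul i, ← h.top_right_mul_mul i] at h₂
  have h₃ := h₂.move_right H i (C := Q') (E := P') (by rw [Function.update_self, hZ])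
  simpa only [Function.update_self, Function.update_idem] using h₃

end IsFactorPair

theorem simpleFactorizationsDescend_of_fin_one {r : RankConditions 1} (D : TableauDiagram r) :
    SimpleFactorizationsDescend D := by
  intro W Q P hs hW
  have hT : D.T 0 1 = Q 0 * D.T 0 1 * P 0 := (show W 0 = D.T 0 1 from hW) ▸ (hs 0).2.1
  have hlen := congrArg (fun T => T.word.length) hT
  simp only [Tableau.length_word_mul] at hlen
  exact ⟨Tableau.eq_empty_of_word_eq_nil (List.length_eq_zero_iff.1 (by omega)),
    Tableau.eq_empty_of_word_eq_nil (List.length_eq_zero_iff.1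
      (by rw [show Fin.last 0 = 0 from rfl]; omega)), trivial⟩

theorem simpleFactorizationsDescend {m : ℕ} {r : RankConditions (m + 1)} (D : TableauDiagram r) :
    SimpleFactorizationsDescend D := by
  induction m with
  | zero => exact simpleFactorizationsDescend_of_fin_one D
  | succ m ih =>
    intro W Q P hs hW
    obtain ⟨Q', P', hW', hQP⟩ := (isFactorSequence_iff D W).1 hW
    have isFactorPair_piecewise (s : Finset (Fin (m + 1 + 1))) :
        IsFactorPair D (s.piecewise Q Q') (s.piecewise P P') := by
      induction s using Finset.induction_on with
      | empty => simpa only [Finset.piecewise_empty] using hQP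
      | insert i s hi ihs =>
        rw [Finset.piecewise_insert, Finset.piecewise_insert]
        refine ihs.update_of_isSimpleFactorization (ih D.bottom) i ?_
        rw [Finset.piecewise_eq_of_notMem _ _ _ hi, Finset.piecewise_eq_of_notMem _ _ _ hi, ← hW']
        exact hs i
    simpa only [Finset.piecewise_univ] using isFactorPair_piecewise Finset.univ

/-- The diagram has `m + 1 ≥ 1` rows; for `i : Fin (m + 1)`, the tableaux `W i`, `Q i`, `P i` are
`W_{i+1}`, `Q_i`, `P_{i+1}` of the factorization `W_{i+1} = Q_i · T_{i,i+1} · P_{i+1}`. -/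
theorem mainTheorem3 (m : ℕ) (r : RankConditions (m + 1)) (D : TableauDiagram r)
    (W Q P : Fin (m + 1) → Tableau)
    (hW : ∀ i : Fin (m + 1), (W i).ContainsUpperLeft (D.T i (i + 1)))
    (hQP : ∀ i : Fin (m + 1), Tableau.IsSimpleFactorization
      (r.numRows i (i + 1)) (r.numCols i (i + 1)) (W i) (Q i) (D.T i (i + 1)) (P i)) :
    IsFactorSequence D W ↔
      Q 0 = ∅ ∧ P (Fin.last m) = ∅ ∧
        IsFactorSequence D.bottom (fun i : Fin m => P i.castSucc * Q i.succ) :=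
  ⟨simpleFactorizationsDescend D W Q P hQP,
    fun h => (isFactorSequence_iff D W).2 ⟨Q, P, fun i => (hQP i).2.1, h⟩⟩
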